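/- **Corollary 4.7.** Let $n\ge 2$ and let $f\in R=\mathbf C[x_1,\dots,x_n]$ be a homogeneous polynomial such that the singular locus ${\rm Sing}\,f^{-1}(0)=\{f=\partial f/\partial x_1=\dots=\partial f/\partial x_n=0\}\subset\mathbf C^n$ has dimension at most $1$ (i.e. $R/(f,\partial f/\partial x_1,\dots,\partial f/\partial x_n)$ has Krull dimension $\le 1$). Let $(\Omega^\bullet,{\rm d})$ be the complex of algebraic differential forms on $\mathbf C^n$. - The *Gauss–Manin complex* $C_f^\bullet$ has components $C_f^j=\Omega^j[\partial_t]=\bigoplus_{i\ge 0}\Omega^j\,\partial_t^i$ and the *algebraic microlocal Gauss–Manin complex* $\widetilde C_f^\bullet$ has components $\widetilde C_f^j=\Omega^j[\partial_t,\partial_t^{-1}]=\bigoplus_{i\in\mathbf Z}\Omega^j\,\partial_t^i$; in both cases the differential is ${\rm d}(\omega\,\partial_t^i)=({\rm d}\omega)\,\partial_t^i-({\rm d}f\wedge\omega)\,\partial_t^{i+1}$. Both carry the decreasing filtration by subcomplexes $P'^p$ $(p\in\mathbf Z)$ whose degree $j$ component is the sum of the $\Omega^j\,\partial_t^i$ with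 $i\le j-p$. The *(microlocal) pole order spectral sequence* is the spectral sequence of $(C_f^\bullet,P')$ (respectively of $(\widetilde C_f^\bullet,P')$): for a filtered complex $(K^\bullet,F)$ put $Z_r^{p,j}=\{x\in F^pK^j\mid {\rm d}x\in F^{p+r}K^{j+1}\}$ and $E_r^{p,j-p}=Z_r^{p,j}/(Z_{r-1}^{p+1,j}+{\rm d}Z_{r-1}^{p-r+1,j-1})$, with differentials ${\rm d}_r:E_r^{p,j-p}\to E_r^{p+r,j+1-p-r}$ induced by ${\rm d}$. It *degenerates at $E_2$* if ${\rm d}_r=0$ for all $r\ge 2$. (These spectral sequences also carry a grading coming from the degree of forms, which plays no role in the vanishing of ${\rm d}_r$.) - Let $A_f^j={\rm Ker}({\rm d}f\wedge:\Omega^j\to\Omega^{j+1})$, a subcomplex of $(\Omega^\bullet,{\rm d})$. Its cohomology $H^nA_f^\bullet$ is the Brieskorn module, on which $t$ acts by multiplication by $f$, and $(H^nA_f^\bullet)_{\rm tor}=\bigcup_{i\ge0}{\rm Ker}\,t^i$ is its $t$-torsion subgroup. The following three conditions are equivalent: (a) the pole order spectral sequence of the Gauss–Manin complex $(C_f^\bullet,P')$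 degenerates at $E_2$; (b) the algebraic microlocal pole order spectral sequence, i.e. that of $(\widetilde C_f^\bullet,P')$, degenerates at $E_2$; (c) the torsion subgroup $(H^nA_f^\bullet)_{\rm tor}$ vanishes. -/

import Mathlib

open scoped TensorProduct
open CategoryTheory

noncomputable section

/-! ## The spectral sequence of a decreasingly filtered cochain complex -/

/-- A cochain complex of `k`-modules with a decreasing filtration `F p` (`p ∈ ℤ`) by
subcomplexes. -/
structure FilteredComplex (k : Type) [CommRing k] where
  /-- the underlying complex -/
  K : CochainComplex (ModuleCat.{0} k) ℕ
  /-- `F p j` is the `p`-th filtration step on the degree `j` component -/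
  F : ℤ → ∀ j : ℕ, Submodule k (K.X j)
  anti : ∀ (j : ℕ) (p q : ℤ), p ≤ q → F q j ≤ F p j
  d_mem : ∀ (p : ℤ) (i j : ℕ) (x : K.X i), x ∈ F p i → (K.d i j).hom x ∈ F p j

namespace FilteredComplex

variable {k : Type} [CommRing k] (C : FilteredComplex k)

/-- `Z_r^p` in total degree `j`: the elements of `F^p K^j` with differential in `F^{p+r} K^{j+1}`. -/
def Z (r p : ℤ) (j : ℕ) : Submodule k (C.K.X j) :=
  C.F p j ⊓ (C.F (p + r) (j + 1)).comap (C.K.d j (j + 1)).hom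

/-- `Z_{r-1}^{p+1} + d Z_{r-1}^{p-r+1}` in total degree `j`; the second summand comes from
total degree `j - 1` (`C.K.d i j = 0` unless `i + 1 = j`). -/
def B (r p : ℤ) (j : ℕ) : Submodule k (C.K.X j) :=
  C.Z (r - 1) (p + 1) j ⊔ ⨆ i : ℕ, (C.Z (r - 1) (p - r + 1) i).map (C.K.d i j).hom

/-- The term `E_r^{p, j-p}` of the spectral sequence,
`Z_r^p / (Z_{r-1}^{p+1} + d Z_{r-1}^{p-r+1})` in total degree `j`. -/
abbrev E (r p : ℤ) (j : ℕ) : Type := C.Z r p j ⧸ (C.B r p j).submoduleOf (C.Z r p j)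

theorem d_d_apply (i j l : ℕ) (x : C.K.X i) : (C.K.d j l).hom ((C.K.d i j).hom x) = 0 := by
  have h := C.K.d_comp_d i j l
  rw [← LinearMap.comp_apply, ← ModuleCat.hom_comp, h]
  rfl

theorem d_mem_Z (r p : ℤ) (j : ℕ) (x : C.K.X j) (hx : x ∈ C.Z r p j) :
    (C.K.d j (j + 1)).hom x ∈ C.Z r (p + r) (j + 1) := by
  refine ⟨hx.2, ?_⟩
  change (C.K.d (j + 1) (j + 1 + 1)).hom ((C.K.d j (j + 1)).hom x) ∈ C.F (p + r + r) (j + 1 + 1)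
  rw [d_d_apply]
  exact Submodule.zero_mem _

/-- The differential of the complex, as a map `Z_r^p → Z_r^{p+r}`. -/
def dZ (r p : ℤ) (j : ℕ) : C.Z r p j →ₗ[k] C.Z r (p + r) (j + 1) :=
  (C.K.d j (j + 1)).hom.restrict (C.d_mem_Z r p j)

theorem d_mem_B (r p : ℤ) (j : ℕ) (x : C.K.X j) (hx : x ∈ C.B r p j) :
    (C.K.d j (j + 1)).hom x ∈ C.B r (p + r) (j + 1) := by
  suffices h : C.B r p j ≤ (C.B r (p + r) (j + 1)).comap (C.K.d j (j + 1)).hom from h hx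
  refine sup_le ?_ (iSup_le fun i => ?_)
  · intro y hy
    refine Submodule.mem_sup_right (Submodule.mem_iSup_of_mem j ?_)
    have e : p + r - r + 1 = p + 1 := by ring
    rw [e]
    exact Submodule.mem_map_of_mem hy
  · rintro _ ⟨y, -, rfl⟩
    rw [Submodule.mem_comap, d_d_apply]
    exact Submodule.zero_mem _

/-- The differential `d_r : E_r^{p, j-p} → E_r^{p+r, (j+1)-(p+r)}` induced by that of the
complex. -/
def dE (r p : ℤ) (j : ℕ) : C.E r p j →ₗ[k] C.E r (p + r) (j + 1) :=
  Submodule.mapQ _ _ (C.dZ r p j) (fun x hx => C.d_mem_B r p j x.1 hx)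

/-- The spectral sequence degenerates at `E_r`: all differentials `d_s` with `s ≥ r` vanish. -/
def DegeneratesAt (r : ℤ) : Prop :=
  ∀ s : ℤ, r ≤ s → ∀ (p : ℤ) (j : ℕ), C.dE s p j = 0

end FilteredComplex

/-! ## Algebraic differential forms on affine space -/

namespace GaussManin

variable {n : ℕ}

/-- `Ω^j`: the algebraic differential forms of degree `j` on `ℂⁿ`, written as polynomials tensored
with the `j`-th exterior power of `ℂⁿ = ⟨dx₁, …, dxₙ⟩`. -/
def Omega (n j : ℕ) : Type :=
  MvPolynomial (Fin n) ℂ ⊗[ℂ] ⋀[ℂ]^j (Fin n → ℂ)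

instance (n j : ℕ) : AddCommGroup (Omega n j) :=
  inferInstanceAs (AddCommGroup (MvPolynomial (Fin n) ℂ ⊗[ℂ] ⋀[ℂ]^j (Fin n → ℂ)))

instance (n j : ℕ) : Module ℂ (Omega n j) :=
  inferInstanceAs (Module ℂ (MvPolynomial (Fin n) ℂ ⊗[ℂ] ⋀[ℂ]^j (Fin n → ℂ)))

/-- The form `g w`, for a polynomial `g` and a form `w` with constant coefficients. -/
def form {j : ℕ} (g : MvPolynomial (Fin n) ℂ) (w : ⋀[ℂ]^j (Fin n → ℂ)) : Omega n j :=
  g ⊗ₜ[ℂ] w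

/-- The linear map `g w ↦ D(g) L(w)`. -/
def mapOmega {j l : ℕ} (D : MvPolynomial (Fin n) ℂ →ₗ[ℂ] MvPolynomial (Fin n) ℂ)
    (L : ⋀[ℂ]^j (Fin n → ℂ) →ₗ[ℂ] ⋀[ℂ]^l (Fin n → ℂ)) : Omega n j →ₗ[ℂ] Omega n l :=
  TensorProduct.map D L

theorem mapOmega_form {j l : ℕ} (D : MvPolynomial (Fin n) ℂ →ₗ[ℂ] MvPolynomial (Fin n) ℂ)
    (L : ⋀[ℂ]^j (Fin n → ℂ) →ₗ[ℂ] ⋀[ℂ]^l (Fin n → ℂ)) (g : MvPolynomial (Fin n) ℂ)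
    (w : ⋀[ℂ]^j (Fin n → ℂ)) : mapOmega D L (form g w) = form (D g) (L w) :=
  rfl

theorem form_add {j : ℕ} (g h : MvPolynomial (Fin n) ℂ) (w : ⋀[ℂ]^j (Fin n → ℂ)) :
    form (g + h) w = form g w + form h w :=
  TensorProduct.add_tmul g h w

theorem form_neg {j : ℕ} (g : MvPolynomial (Fin n) ℂ) (w : ⋀[ℂ]^j (Fin n → ℂ)) :
    form g (-w) = -form g w :=
  TensorProduct.tmul_neg g w

theorem Omega.induction {j : ℕ} {P : Omega n j → Prop} (x : Omega n j) (zero : P 0)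
    (add : ∀ x y, P x → P y → P (x + y)) (form : ∀ g w, P (form g w)) : P x :=
  TensorProduct.induction_on x zero form add

/-- The generator `dx_i` of the exterior algebra. -/
def dx (i : Fin n) : ExteriorAlgebra ℂ (Fin n → ℂ) :=
  ExteriorAlgebra.ι ℂ (Pi.single i 1)

theorem dx_mul_mem {j : ℕ} (i : Fin n) (w : ExteriorAlgebra ℂ (Fin n → ℂ))
    (hw : w ∈ ⋀[ℂ]^j (Fin n → ℂ)) : dx i * w ∈ ⋀[ℂ]^(j + 1) (Fin n → ℂ) := by
  rw [ExteriorAlgebra.exteriorPower, pow_succ']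
  exact Submodule.mul_mem_mul ⟨_, rfl⟩ hw

/-- The map `w ↦ dx_i ∧ w` on forms with constant coefficients. -/
def dxWedge (i : Fin n) (j : ℕ) : ⋀[ℂ]^j (Fin n → ℂ) →ₗ[ℂ] ⋀[ℂ]^(j + 1) (Fin n → ℂ) :=
  (LinearMap.mulLeft ℂ (dx i)).restrict (dx_mul_mem i)

theorem dxWedge_dxWedge (i i' : Fin n) (j : ℕ) (w : ⋀[ℂ]^j (Fin n → ℂ)) :
    dxWedge i (j + 1) (dxWedge i' j w) = -dxWedge i' (j + 1) (dxWedge i j w) := by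
  refine Subtype.ext ?_
  change dx i * (dx i' * w.1) = -(dx i' * (dx i * w.1))
  rw [← mul_assoc, ← mul_assoc, ← neg_mul]
  congr 1
  rw [eq_neg_iff_add_eq_zero]
  exact ExteriorAlgebra.ι_add_mul_swap _ _

/-- The exterior derivative `d : Ω^j → Ω^{j+1}`, `d(g w) = ∑ i, (∂g/∂x_i) dx_i ∧ w` for `w` with
constant coefficients. -/
def dOmega (n j : ℕ) : Omega n j →ₗ[ℂ] Omega n (j + 1) :=
  ∑ i : Fin n, mapOmega (MvPolynomial.pderiv (R := ℂ) i).toLinearMap (dxWedge i j)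

/-- The map `df ∧ : Ω^j → Ω^{j+1}`, where `df = ∑ i, (∂f/∂x_i) dx_i`. -/
def wedgeOmega (f : MvPolynomial (Fin n) ℂ) (j : ℕ) : Omega n j →ₗ[ℂ] Omega n (j + 1) :=
  ∑ i : Fin n, mapOmega (LinearMap.mulLeft ℂ (MvPolynomial.pderiv i f)) (dxWedge i j)

/-- Multiplication by `f` on `Ω^j`. -/
def mulOmega (f : MvPolynomial (Fin n) ℂ) (j : ℕ) : Omega n j →ₗ[ℂ] Omega n j :=
  mapOmega (LinearMap.mulLeft ℂ f) LinearMap.id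

theorem dOmega_form {j : ℕ} (g : MvPolynomial (Fin n) ℂ) (w : ⋀[ℂ]^j (Fin n → ℂ)) :
    dOmega n j (form g w) = ∑ i : Fin n, form (MvPolynomial.pderiv i g) (dxWedge i j w) := by
  simp [dOmega, LinearMap.sum_apply, mapOmega_form]

theorem wedgeOmega_form {j : ℕ} (f g : MvPolynomial (Fin n) ℂ) (w : ⋀[ℂ]^j (Fin n → ℂ)) :
    wedgeOmega f j (form g w) =
      ∑ i : Fin n, form (MvPolynomial.pderiv i f * g) (dxWedge i j w) := by
  simp [wedgeOmega, LinearMap.sum_apply, mapOmega_form]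

theorem mulOmega_form {j : ℕ} (f g : MvPolynomial (Fin n) ℂ) (w : ⋀[ℂ]^j (Fin n → ℂ)) :
    mulOmega f j (form g w) = form (f * g) w := by
  simp [mulOmega, mapOmega_form]

theorem pderiv_comm (i j : Fin n) (g : MvPolynomial (Fin n) ℂ) :
    MvPolynomial.pderiv i (MvPolynomial.pderiv j g) =
      MvPolynomial.pderiv j (MvPolynomial.pderiv i g) := by
  have h : ⁅MvPolynomial.pderiv (R := ℂ) i, MvPolynomial.pderiv (R := ℂ) j⁆ = 0 := by
    refine MvPolynomial.derivation_ext fun k => ?_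
    rw [Derivation.commutator_apply, MvPolynomial.pderiv_X, MvPolynomial.pderiv_X]
    simp only [Pi.single_apply]
    split_ifs <;> simp
  have h2 := congrArg (fun D : Derivation ℂ (MvPolynomial (Fin n) ℂ) (MvPolynomial (Fin n) ℂ) => D g) h
  simpa [Derivation.commutator_apply, sub_eq_zero] using h2

theorem sum_symm_eq_zero {j : ℕ} (a : Fin n → Fin n → MvPolynomial (Fin n) ℂ)
    (ha : ∀ i i', a i i' = a i' i) (w : ⋀[ℂ]^j (Fin n → ℂ)) :
    ∑ i : Fin n, ∑ i' : Fin n, form (a i i') (dxWedge i' (j + 1) (dxWedge i j w)) = 0 := by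
  have h : ∑ i : Fin n, ∑ i' : Fin n, form (a i i') (dxWedge i' (j + 1) (dxWedge i j w)) =
      -∑ i : Fin n, ∑ i' : Fin n, form (a i i') (dxWedge i' (j + 1) (dxWedge i j w)) := by
    conv_lhs => rw [Finset.sum_comm]
    rw [← Finset.sum_neg_distrib]
    refine Finset.sum_congr rfl fun i _ => ?_
    rw [← Finset.sum_neg_distrib]
    refine Finset.sum_congr rfl fun i' _ => ?_
    rw [ha, dxWedge_dxWedge, form_neg]
  have h2 : (2 : ℂ) •
      ∑ i : Fin n, ∑ i' : Fin n, form (a i i') (dxWedge i' (j + 1) (dxWedge i j w)) = 0 := by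
    rw [two_smul]
    exact eq_neg_iff_add_eq_zero.mp h
  exact (smul_eq_zero.mp h2).resolve_left two_ne_zero

theorem dOmega_dOmega {j : ℕ} (x : Omega n j) : dOmega n (j + 1) (dOmega n j x) = 0 := by
  induction x using Omega.induction with
  | zero => simp
  | add x y hx hy => rw [map_add, map_add, hx, hy, add_zero]
  | form g w =>
    simp only [dOmega_form, map_sum]
    exact sum_symm_eq_zero (fun i i' => MvPolynomial.pderiv i' (MvPolynomial.pderiv i g))
      (fun i i' => pderiv_comm _ _ _) w

/-- Leibniz rule for functions. -/
theorem dOmega_mulOmega {j : ℕ} (f : MvPolynomial (Fin n) ℂ) (x : Omega n j) :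
    dOmega n j (mulOmega f j x) = wedgeOmega f j x + mulOmega f (j + 1) (dOmega n j x) := by
  induction x using Omega.induction with
  | zero => simp
  | add x y hx hy => rw [map_add, map_add, hx, hy, map_add, map_add, map_add]; abel
  | form g w =>
    rw [mulOmega_form, dOmega_form, dOmega_form, wedgeOmega_form, map_sum,
      ← Finset.sum_add_distrib]
    refine Finset.sum_congr rfl fun i _ => ?_
    rw [mulOmega_form, ← form_add, Derivation.leibniz, smul_eq_mul, smul_eq_mul]
    congr 1
    ring

theorem wedgeOmega_wedgeOmega {j : ℕ} (f : MvPolynomial (Fin n) ℂ) (x : Omega n j) :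
    wedgeOmega f (j + 1) (wedgeOmega f j x) = 0 := by
  induction x using Omega.induction with
  | zero => simp
  | add x y hx hy => rw [map_add, map_add, hx, hy, add_zero]
  | form g w =>
    simp only [wedgeOmega_form, map_sum]
    exact sum_symm_eq_zero
      (fun i i' => MvPolynomial.pderiv i' f * (MvPolynomial.pderiv i f * g))
      (fun i i' => by ring) w

theorem dOmega_wedgeOmega {j : ℕ} (f : MvPolynomial (Fin n) ℂ) (x : Omega n j) :
    dOmega n (j + 1) (wedgeOmega f j x) = -wedgeOmega f (j + 1) (dOmega n j x) := by
  have h := dOmega_dOmega (mulOmega f j x)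
  rw [dOmega_mulOmega, map_add, dOmega_mulOmega, dOmega_dOmega, map_zero, add_zero] at h
  exact eq_neg_of_add_eq_zero_left h

theorem wedgeOmega_mulOmega {j : ℕ} (f g : MvPolynomial (Fin n) ℂ) (x : Omega n j) :
    wedgeOmega f j (mulOmega g j x) = mulOmega g (j + 1) (wedgeOmega f j x) := by
  induction x using Omega.induction with
  | zero => simp
  | add x y hx hy => rw [map_add, map_add, hx, hy, map_add, map_add]
  | form h w =>
    rw [mulOmega_form, wedgeOmega_form, wedgeOmega_form, map_sum]
    refine Finset.sum_congr rfl fun i _ => ?_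
    rw [mulOmega_form]
    congr 1
    ring

/-! ## The Brieskorn modules -/

/-- `A_f^j = Ker (df ∧ : Ω^j → Ω^{j+1})`. -/
def A (f : MvPolynomial (Fin n) ℂ) (j : ℕ) : Submodule ℂ (Omega n j) :=
  LinearMap.ker (wedgeOmega f j)

theorem dOmega_mem_A (f : MvPolynomial (Fin n) ℂ) (j : ℕ) (x : Omega n j) (hx : x ∈ A f j) :
    dOmega n j x ∈ A f (j + 1) := by
  have h : wedgeOmega f j x = 0 := hx
  change wedgeOmega f (j + 1) (dOmega n j x) = 0
  rw [← neg_eq_zero, ← dOmega_wedgeOmega, h, map_zero]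

/-- The differential of `A_f`, induced by the exterior derivative. -/
def dA (f : MvPolynomial (Fin n) ℂ) (j : ℕ) : A f j →ₗ[ℂ] A f (j + 1) :=
  (dOmega n j).restrict (dOmega_mem_A f j)

/-- The complex `(A_f, d)`. -/
def complexA (f : MvPolynomial (Fin n) ℂ) : CochainComplex (ModuleCat.{0} ℂ) ℕ :=
  CochainComplex.of (fun j => ModuleCat.of ℂ (A f j)) (fun j => ModuleCat.ofHom (dA f j))
    (fun j => by
      refine ModuleCat.hom_ext (LinearMap.ext fun x => ?_)
      exact Subtype.ext (dOmega_dOmega x.1))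

theorem mulOmega_mem_A (f : MvPolynomial (Fin n) ℂ) (j : ℕ) (x : Omega n j) (hx : x ∈ A f j) :
    mulOmega f j x ∈ A f j := by
  have h : wedgeOmega f j x = 0 := hx
  change wedgeOmega f j (mulOmega f j x) = 0
  rw [wedgeOmega_mulOmega, h, map_zero]

/-- Multiplication by `f` on `A_f^j`. -/
def mulA (f : MvPolynomial (Fin n) ℂ) (j : ℕ) : A f j →ₗ[ℂ] A f j :=
  (mulOmega f j).restrict (mulOmega_mem_A f j)

theorem complexA_d (f : MvPolynomial (Fin n) ℂ) (j : ℕ) :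
    (complexA f).d j (j + 1) = ModuleCat.ofHom (dA f j) :=
  CochainComplex.of_d (fun j => ModuleCat.of ℂ (A f j)) (fun j => ModuleCat.ofHom (dA f j)) j

/-- The action of `t` on the complex `A_f`: multiplication by `f`. -/
def tA (f : MvPolynomial (Fin n) ℂ) : complexA f ⟶ complexA f :=
  CochainComplex.ofHom (X := complexA f) (Y := complexA f)
    (fun j => ModuleCat.ofHom (mulA f j)) (fun j => by
      rw [complexA_d]
      refine ModuleCat.hom_ext (LinearMap.ext fun x => ?_)
      refine Subtype.ext ?_
      have h : wedgeOmega f j x.1 = 0 := x.2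
      change dOmega n j (mulOmega f j x.1) = mulOmega f (j + 1) (dOmega n j x.1)
      rw [dOmega_mulOmega, h, zero_add])

/-- The Brieskorn module `H^j A_f`. -/
abbrev Brieskorn (f : MvPolynomial (Fin n) ℂ) (j : ℕ) : ModuleCat.{0} ℂ :=
  (complexA f).homology j

/-- The action of `t` on the Brieskorn module `H^j A_f`. -/
def tBrieskorn (f : MvPolynomial (Fin n) ℂ) (j : ℕ) : Module.End ℂ (Brieskorn f j) :=
  (HomologicalComplex.homologyMap (tA f) j).hom

/-- The `t`-torsion of `H^j A_f`: the union of the kernel filtration `K_i = Ker t^i`. -/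
def brieskornTorsion (f : MvPolynomial (Fin n) ℂ) (j : ℕ) : Submodule ℂ (Brieskorn f j) :=
  ⨆ i : ℕ, LinearMap.ker (tBrieskorn f j ^ i)

/-! ## The Gauss-Manin complexes and their pole order filtrations

Both complexes are given by the same formulas. The exponents of `∂_t` run over `ι = ℕ` for the
Gauss-Manin complex `Ω^•[∂_t]` and over `ι = ℤ` for the algebraic microlocal Gauss-Manin complex
`Ω^•[∂_t, ∂_t⁻¹]`; an element `∑ i, ω_i ∂_t^i` is the finitely supported function `i ↦ ω_i`. -/

section

variable (ι : Type) [AddCommMonoidWithOne ι]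

/-- The differential `d(ω ∂_t^i) = (dω) ∂_t^i - (df ∧ ω) ∂_t^{i+1}`. -/
def gmD (f : MvPolynomial (Fin n) ℂ) (j : ℕ) : (ι →₀ Omega n j) →ₗ[ℂ] (ι →₀ Omega n (j + 1)) :=
  Finsupp.lsum ℂ fun i : ι =>
    Finsupp.lsingle i ∘ₗ dOmega n j - Finsupp.lsingle (i + 1) ∘ₗ wedgeOmega f j

theorem gmD_single (f : MvPolynomial (Fin n) ℂ) (j : ℕ) (i : ι) (w : Omega n j) :
    gmD ι f j (Finsupp.single i w) =
      Finsupp.single i (dOmega n j w) - Finsupp.single (i + 1) (wedgeOmega f j w) := by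
  simp [gmD]

theorem gmD_gmD (f : MvPolynomial (Fin n) ℂ) (j : ℕ) (x : ι →₀ Omega n j) :
    gmD ι f (j + 1) (gmD ι f j x) = 0 := by
  induction x using Finsupp.induction_linear with
  | zero => simp
  | add x y hx hy => rw [map_add, map_add, hx, hy, add_zero]
  | single i w =>
    simp [gmD_single, dOmega_dOmega, wedgeOmega_wedgeOmega, dOmega_wedgeOmega]

/-- The complex with components `⨁_i Ω^j ∂_t^i`, `i ∈ ι`. -/
def gmComplex (f : MvPolynomial (Fin n) ℂ) : CochainComplex (ModuleCat.{0} ℂ) ℕ :=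
  CochainComplex.of (fun j => ModuleCat.of ℂ (ι →₀ Omega n j))
    (fun j => ModuleCat.ofHom (gmD ι f j))
    (fun j => by
      refine ModuleCat.hom_ext (LinearMap.ext fun x => ?_)
      exact gmD_gmD ι f j x)

variable (ord : ι → ℤ)

/-- The filtration `P'^p = ⨁_{i ≤ j - p} Ω^j ∂_t^i` on the degree `j` component, where `ord` is
the inclusion of the exponents `ι` in `ℤ`. -/
def poleFiltration (n : ℕ) (p : ℤ) (j : ℕ) : Submodule ℂ (ι →₀ Omega n j) :=
  Finsupp.supported (Omega n j) ℂ {i : ι | ord i ≤ (j : ℤ) - p}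

variable {ι ord}

theorem poleFiltration_d (hord : ∀ i, ord (i + 1) = ord i + 1)
    (f : MvPolynomial (Fin n) ℂ) (p : ℤ) (j : ℕ) (x : ι →₀ Omega n j)
    (hx : x ∈ poleFiltration ι ord n p j) :
    gmD ι f j x ∈ poleFiltration ι ord n p (j + 1) := by
  rw [gmD, Finsupp.lsum_apply]
  refine Submodule.sum_mem _ fun i hi => ?_
  have hi' : ord i ≤ (j : ℤ) - p := hx hi
  refine Submodule.sub_mem _ (Finsupp.single_mem_supported ℂ _ ?_)
    (Finsupp.single_mem_supported ℂ _ ?_)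
  · change ord i ≤ ((j + 1 : ℕ) : ℤ) - p
    push_cast
    linarith
  · change ord (i + 1) ≤ ((j + 1 : ℕ) : ℤ) - p
    rw [hord]
    push_cast
    linarith

variable (ι ord)

/-- The complex `⨁_i Ω^• ∂_t^i`, `i ∈ ι`, with its filtration `P'`. -/
def gmFiltered (hord : ∀ i, ord (i + 1) = ord i + 1) (f : MvPolynomial (Fin n) ℂ) :
    FilteredComplex ℂ where
  K := gmComplex ι f
  F p j := poleFiltration ι ord n p j
  anti j p q hpq := Finsupp.supported_mono fun i (hi : ord i ≤ (j : ℤ) - q) => by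
    change ord i ≤ (j : ℤ) - p
    linarith
  d_mem p i j x hx := by
    by_cases h : i + 1 = j
    · subst h
      have e : (gmComplex ι f).d i (i + 1) = ModuleCat.ofHom (gmD ι f i) :=
        CochainComplex.of_d (fun j => ModuleCat.of ℂ (ι →₀ Omega n j))
          (fun j => ModuleCat.ofHom (gmD ι f j)) i
      rw [e]
      exact poleFiltration_d hord f p i x hx
    · rw [(gmComplex ι f).shape i j h]
      exact Submodule.zero_mem _

end

/-- The Gauss-Manin complex `C_f = Ω^•[∂_t]`, filtered by the pole order filtration `P'`. -/
def gaussManin (f : MvPolynomial (Fin n) ℂ) : FilteredComplex ℂ :=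
  gmFiltered ℕ (fun i => (i : ℤ)) (fun i => by push_cast; rfl) f

/-- The algebraic microlocal Gauss-Manin complex `Ω^•[∂_t, ∂_t⁻¹]`, filtered by the pole order
filtration `P'`. -/
def microlocalGaussManin (f : MvPolynomial (Fin n) ℂ) : FilteredComplex ℂ :=
  gmFiltered ℤ (fun i => i) (fun _ => rfl) f

/-- The ideal `(f, ∂f/∂x₁, …, ∂f/∂xₙ)` of the singular locus `Sing f⁻¹(0)` in `ℂⁿ`. -/
def singIdeal (f : MvPolynomial (Fin n) ℂ) : Ideal (MvPolynomial (Fin n) ℂ) :=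
  Ideal.span (insert f (Set.range fun i : Fin n => MvPolynomial.pderiv i f))

end GaussManin

end

/-! For `x = ∑ x_i ∂_t^i` the coefficient of `dx` at `∂_t^i` is `d x_i - df ∧ x_{i-1}`. If these
vanish above order `q`, the coefficients of `x` from order `q` upwards form a chain: the top one is
killed by `df ∧`, and `df ∧ x_i = d x_{i+1}` below it. Let `chainEnd f j k` consist of the lowest
forms of chains of `k + 1` forms. All `d_r` with `r ≥ 2` vanish exactly when `d` sends chain ends
into `d A_f^j`, enlarged by `df ∧ Ω^j` at those exponents that have a predecessor
(`degeneratesAt_two_iff`). The exponent `0` of `Ω^•[∂_t]` has none, so (a) says `d(chain ends) ⊆ d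
A_f^j` for all `j` (`ChainsSplit`), while (b) says this only modulo `df ∧ Ω^j`.

Only `j = n - 1` matters. For larger `j` there are no `(j+1)`-forms. For smaller `j` and `deg f >
0`, the bound on the singular locus makes the Koszul complex of the partial derivatives exact, and
exactness lets one straighten chains (`chainsSplit_of_koszulExact`). Koszul exactness comes from a
general linear form `l` that cuts the singular locus down to the origin: `l` and powers of all but
one of the variables form a regular sequence, contractions give homotopies modulo `l`, and the
grading removes `l` again.

In degree `n - 1`, (b) gives (a) by induction on the polynomial degree (`chainsSplit_of_le_sup`).
For (c), contraction with the Euler field writes a homogeneous top form `ω` as `dη` with `df ∧ η = c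
f ω`, `c ≠ 0`. Thus `f ω ∈ d A_f^{n-1}` says that `η` is a chain end, and splitting of chains
becomes injectivity of `t` on `H^n A_f = Ω^n / d A_f^{n-1}` (`chainsSplit_iff_mulOmega`). If `f` is
constant, `df = 0` and all three conditions hold. -/

noncomputable section

namespace GaussManin

variable {n : ℕ}

/-! ### Grading of forms by the degree of their coefficients -/

open MvPolynomial in
theorem homogeneousComponent_mul_of_isHomogeneous {k : ℕ} {a : MvPolynomial (Fin n) ℂ}
    (ha : a.IsHomogeneous k) (e : ℕ) (g : MvPolynomial (Fin n) ℂ) :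
    homogeneousComponent e (a * g) =
      if k ≤ e then a * homogeneousComponent (e - k) g else 0 := by
  conv_lhs => rw [← sum_homogeneousComponent g, Finset.mul_sum, map_sum]
  have h : ∀ i, homogeneousComponent e (a * homogeneousComponent i g) =
      if e = k + i then a * homogeneousComponent i g else 0 := fun i =>
    homogeneousComponent_of_mem (ha.mul (homogeneousComponent_isHomogeneous i g))
  simp only [h]
  split_ifs with hk
  · obtain ⟨m, rfl⟩ := Nat.exists_eq_add_of_le hk
    simp only [add_right_inj, Nat.add_sub_cancel_left]
    rw [Finset.sum_ite_eq]
    split_ifs with hm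
    · rfl
    · rw [homogeneousComponent_eq_zero, mul_zero]
      simpa [Nat.lt_succ_iff] using hm
  · exact Finset.sum_eq_zero fun i _ => if_neg (by omega)

open MvPolynomial in
theorem homogeneousComponent_pderiv (m : ℕ) (i : Fin n) (g : MvPolynomial (Fin n) ℂ) :
    homogeneousComponent m (pderiv i g) = pderiv i (homogeneousComponent (m + 1) g) := by
  conv_lhs => rw [← sum_homogeneousComponent g, map_sum, map_sum]
  have h : ∀ k, homogeneousComponent m (pderiv i (homogeneousComponent k g)) =
      if m + 1 = k then pderiv i (homogeneousComponent k g) else 0 := by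
    intro k
    cases k with
    | zero => simp [homogeneousComponent_zero]
    | succ k =>
      rw [homogeneousComponent_of_mem
        (homogeneousComponent_isHomogeneous (k + 1) g).pderiv]
      simp
  simp only [h]
  rw [Finset.sum_ite_eq]
  split_ifs with hm
  · rfl
  · rw [homogeneousComponent_eq_zero, map_zero]
    simpa [Nat.lt_succ_iff] using hm

/-- The part of a form whose coefficients are homogeneous polynomials of degree `m`. -/
def comp (m j : ℕ) : Omega n j →ₗ[ℂ] Omega n j :=
  mapOmega (MvPolynomial.homogeneousComponent m) LinearMap.id

theorem comp_form {j : ℕ} (m : ℕ) (g : MvPolynomial (Fin n) ℂ) (w : ⋀[ℂ]^j (Fin n → ℂ)) :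
    comp m j (form g w) = form (MvPolynomial.homogeneousComponent m g) w := by
  simp [comp, mapOmega_form]

theorem form_zero_left {j : ℕ} (w : ⋀[ℂ]^j (Fin n → ℂ)) : form (0 : MvPolynomial (Fin n) ℂ) w = 0 :=
  TensorProduct.zero_tmul _ w

theorem form_smul {j : ℕ} (c : ℂ) (g : MvPolynomial (Fin n) ℂ) (w : ⋀[ℂ]^j (Fin n → ℂ)) :
    form (c • g) w = c • form g w :=
  rfl

theorem form_smul_right {j : ℕ} (c : ℂ) (g : MvPolynomial (Fin n) ℂ) (w : ⋀[ℂ]^j (Fin n → ℂ)) :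
    form g (c • w) = c • form g w :=
  TensorProduct.tmul_smul c g w

theorem form_sum_left {j : ℕ} {α : Type*} (s : Finset α) (g : α → MvPolynomial (Fin n) ℂ)
    (w : ⋀[ℂ]^j (Fin n → ℂ)) : form (∑ i ∈ s, g i) w = ∑ i ∈ s, form (g i) w :=
  TensorProduct.sum_tmul s g w

theorem form_sum_right {j : ℕ} {α : Type*} (s : Finset α) (g : MvPolynomial (Fin n) ℂ)
    (w : α → ⋀[ℂ]^j (Fin n → ℂ)) : form g (∑ i ∈ s, w i) = ∑ i ∈ s, form g (w i) :=
  TensorProduct.tmul_sum g s w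

theorem comp_comp {j : ℕ} (m : ℕ) (x : Omega n j) : comp m j (comp m j x) = comp m j x := by
  induction x using Omega.induction with
  | zero => simp
  | add x y hx hy => simp only [map_add, hx, hy]
  | form g w =>
    rw [comp_form, comp_form, MvPolynomial.homogeneousComponent_eq_self
      (MvPolynomial.homogeneousComponent_isHomogeneous m g)]

theorem dOmega_comp_succ {j : ℕ} (m : ℕ) (x : Omega n j) :
    dOmega n j (comp (m + 1) j x) = comp m (j + 1) (dOmega n j x) := by
  induction x using Omega.induction with
  | zero => simp
  | add x y hx hy => simp only [map_add, hx, hy]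
  | form g w =>
    simp only [comp_form, dOmega_form, map_sum, homogeneousComponent_pderiv]

theorem dOmega_comp_zero {j : ℕ} (x : Omega n j) : dOmega n j (comp 0 j x) = 0 := by
  induction x using Omega.induction with
  | zero => simp
  | add x y hx hy => simp only [map_add, hx, hy, add_zero]
  | form g w =>
    simp [comp_form, dOmega_form, MvPolynomial.homogeneousComponent_zero, form_zero_left]

/-- The truncated `d - 1` is harmless: for `d = 0` the form `df` vanishes and both sides are zero.
-/
theorem comp_wedgeOmega {f : MvPolynomial (Fin n) ℂ} {d : ℕ} (hf : f.IsHomogeneous d) {j : ℕ}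
    (e : ℕ) (x : Omega n j) :
    comp e (j + 1) (wedgeOmega f j x) =
      if d - 1 ≤ e then wedgeOmega f j (comp (e - (d - 1)) j x) else 0 := by
  induction x using Omega.induction with
  | zero => simp
  | add x y hx hy =>
    simp only [map_add, hx, hy]
    split_ifs <;> simp
  | form g w =>
    simp only [wedgeOmega_form, comp_form, map_sum,
      homogeneousComponent_mul_of_isHomogeneous (hf.pderiv)]
    split_ifs <;> simp [form_zero_left]

theorem comp_mulOmega {f : MvPolynomial (Fin n) ℂ} {d : ℕ} (hf : f.IsHomogeneous d) {j : ℕ}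
    (e : ℕ) (x : Omega n j) :
    comp e j (mulOmega f j x) = if d ≤ e then mulOmega f j (comp (e - d) j x) else 0 := by
  induction x using Omega.induction with
  | zero => simp
  | add x y hx hy =>
    simp only [map_add, hx, hy]
    split_ifs <;> simp
  | form g w =>
    simp only [mulOmega_form, comp_form, homogeneousComponent_mul_of_isHomogeneous hf]
    split_ifs <;> simp [form_zero_left]

theorem exists_sum_comp {j : ℕ} (x : Omega n j) :
    ∃ N, ∀ M, N ≤ M → ∑ m ∈ Finset.range M, comp m j x = x := by
  induction x using Omega.induction with
  | zero => exact ⟨0, by simp⟩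
  | add x y hx hy =>
    obtain ⟨N, hN⟩ := hx
    obtain ⟨N', hN'⟩ := hy
    refine ⟨max N N', fun M hM => ?_⟩
    simp only [map_add, Finset.sum_add_distrib]
    rw [hN M (le_trans (le_max_left _ _) hM), hN' M (le_trans (le_max_right _ _) hM)]
  | form g w =>
    refine ⟨g.totalDegree + 1, fun M hM => ?_⟩
    simp only [comp_form, ← form_sum_left]
    congr 1
    conv_rhs => rw [← MvPolynomial.sum_homogeneousComponent g]
    refine (Finset.sum_subset (Finset.range_subset_range.2 hM) fun i _ hi => ?_).symm
    refine MvPolynomial.homogeneousComponent_eq_zero _ _ ?_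
    simpa [Nat.lt_succ_iff] using hi

theorem mem_of_comp_mem {j : ℕ} (W : Submodule ℂ (Omega n j)) {x : Omega n j}
    (h : ∀ m, comp m j x ∈ W) : x ∈ W := by
  obtain ⟨N, hN⟩ := exists_sum_comp x
  rw [← hN N le_rfl]
  exact Submodule.sum_mem _ fun m _ => h m

/-! ### Contractions -/

/-- Contraction with the `i`-th coordinate vector field. -/
def contract (i : Fin n) : ExteriorAlgebra ℂ (Fin n → ℂ) →ₗ[ℂ] ExteriorAlgebra ℂ (Fin n → ℂ) :=
  CliffordAlgebra.contractLeft (Q := (0 : QuadraticForm ℂ (Fin n → ℂ)))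
    (LinearMap.proj (R := ℂ) (φ := fun _ : Fin n => ℂ) i)

theorem contract_ι_mul (i : Fin n) (v : Fin n → ℂ) (w : ExteriorAlgebra ℂ (Fin n → ℂ)) :
    contract i (ExteriorAlgebra.ι ℂ v * w) =
      v i • w - ExteriorAlgebra.ι ℂ v * contract i w :=
  CliffordAlgebra.contractLeft_ι_mul _ _ _

theorem contract_of_mem_zero (i : Fin n) (w : ExteriorAlgebra ℂ (Fin n → ℂ))
    (hw : w ∈ ⋀[ℂ]^0 (Fin n → ℂ)) : contract i w = 0 := by
  rw [ExteriorAlgebra.exteriorPower, pow_zero, Submodule.mem_one] at hw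
  obtain ⟨c, rfl⟩ := hw
  exact CliffordAlgebra.contractLeft_algebraMap (Q := (0 : QuadraticForm ℂ (Fin n → ℂ))) _ c

theorem exteriorPower_succ_induction {j : ℕ} {P : ExteriorAlgebra ℂ (Fin n → ℂ) → Prop}
    (hmul : ∀ v, ∀ u ∈ ⋀[ℂ]^j (Fin n → ℂ), P (ExteriorAlgebra.ι ℂ v * u))
    (hadd : ∀ x y, P x → P y → P (x + y)) {w : ExteriorAlgebra ℂ (Fin n → ℂ)}
    (hw : w ∈ ⋀[ℂ]^(j + 1) (Fin n → ℂ)) : P w := by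
  rw [ExteriorAlgebra.exteriorPower, pow_succ'] at hw
  refine Submodule.mul_induction_on hw ?_ hadd
  rintro _ ⟨v, rfl⟩ u hu
  exact hmul v u hu

theorem contract_mem (i : Fin n) (j : ℕ) (w : ExteriorAlgebra ℂ (Fin n → ℂ))
    (hw : w ∈ ⋀[ℂ]^(j + 1) (Fin n → ℂ)) : contract i w ∈ ⋀[ℂ]^j (Fin n → ℂ) := by
  induction j generalizing w with
  | zero =>
    refine exteriorPower_succ_induction (P := fun w => contract i w ∈ ⋀[ℂ]^0 (Fin n → ℂ))
      (fun v u hu => ?_) (fun x y hx hy => ?_) hw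
    · rw [contract_ι_mul, contract_of_mem_zero i u hu, mul_zero, sub_zero]
      exact Submodule.smul_mem _ _ hu
    · rw [map_add]; exact Submodule.add_mem _ hx hy
  | succ j ih =>
    refine exteriorPower_succ_induction (P := fun w => contract i w ∈ ⋀[ℂ]^(j + 1) (Fin n → ℂ))
      (fun v u hu => ?_) (fun x y hx hy => ?_) hw
    · rw [contract_ι_mul]
      refine Submodule.sub_mem _ (Submodule.smul_mem _ _ hu) ?_
      have h := ih u hu
      rw [ExteriorAlgebra.exteriorPower, pow_succ']
      exact Submodule.mul_mem_mul ⟨_, rfl⟩ h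
    · rw [map_add]; exact Submodule.add_mem _ hx hy

/-- The operator counts factors: moving it past a vector `v` leaves one extra term `v ∧ u`, so its
eigenvalue grows by one with each factor. -/
theorem sum_dx_mul_contract (j : ℕ) (w : ExteriorAlgebra ℂ (Fin n → ℂ))
    (hw : w ∈ ⋀[ℂ]^j (Fin n → ℂ)) : ∑ i, dx i * contract i w = (j : ℂ) • w := by
  induction j generalizing w with
  | zero => simp [contract_of_mem_zero _ w hw]
  | succ j ih =>
    refine exteriorPower_succ_induction
      (P := fun w => ∑ i, dx i * contract i w = ((j + 1 : ℕ) : ℂ) • w)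
      (fun v u hu => ?_) (fun x y hx hy => ?_) hw
    · have h1 : ∀ i, dx i * contract i (ExteriorAlgebra.ι ℂ v * u) =
          ExteriorAlgebra.ι ℂ (v i • Pi.single i 1) * u +
            ExteriorAlgebra.ι ℂ v * (dx i * contract i u) := by
        intro i
        have h2 := ExteriorAlgebra.ι_add_mul_swap (R := ℂ) (Pi.single i 1) v
        rw [contract_ι_mul, mul_sub, ← mul_assoc (dx i), ← mul_assoc (ExteriorAlgebra.ι ℂ v),
          dx, eq_neg_of_add_eq_zero_left h2]
        simp
      simp only [h1]
      rw [Finset.sum_add_distrib, ← Finset.mul_sum, ih u hu, ← Finset.sum_mul, ← map_sum]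
      have h3 : ∑ i, v i • (Pi.single i (1 : ℂ) : Fin n → ℂ) = v := by
        simpa using (pi_eq_sum_univ' v).symm
      rw [h3]
      push_cast
      rw [add_smul, one_smul, mul_smul_comm, add_comm]
    · simp only [map_add, mul_add, Finset.sum_add_distrib, hx, hy, smul_add]

/-- Contraction with the `i`-th coordinate vector field on forms with constant coefficients. -/
def contractForm (i : Fin n) (j : ℕ) : ⋀[ℂ]^(j + 1) (Fin n → ℂ) →ₗ[ℂ] ⋀[ℂ]^j (Fin n → ℂ) :=
  (contract i).restrict (contract_mem i j)

theorem contractForm_dxWedge (i k : Fin n) (j : ℕ) (w : ⋀[ℂ]^(j + 1) (Fin n → ℂ)) :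
    contractForm i (j + 1) (dxWedge k (j + 1) w) =
      (if i = k then (1 : ℂ) else 0) • w - dxWedge k j (contractForm i j w) := by
  refine Subtype.ext ?_
  change contract i (dx k * w.1) = (if i = k then (1 : ℂ) else 0) • w.1 - dx k * contract i w.1
  rw [dx, contract_ι_mul, Pi.single_apply]

theorem contractForm_dxWedge_zero (i k : Fin n) (w : ⋀[ℂ]^0 (Fin n → ℂ)) :
    contractForm i 0 (dxWedge k 0 w) = (if i = k then (1 : ℂ) else 0) • w := by
  refine Subtype.ext ?_
  change contract i (dx k * w.1) = (if i = k then (1 : ℂ) else 0) • w.1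
  rw [dx, contract_ι_mul, Pi.single_apply, contract_of_mem_zero i w.1 w.2, mul_zero, sub_zero]

theorem sum_dxWedge_contractForm (j : ℕ) (w : ⋀[ℂ]^(j + 1) (Fin n → ℂ)) :
    ∑ i, dxWedge i j (contractForm i j w) = ((j + 1 : ℕ) : ℂ) • w := by
  refine Subtype.ext ?_
  have h := sum_dx_mul_contract (j + 1) w.1 w.2
  rw [Submodule.coe_sum]
  exact h

/-- Contraction with the vector field `∑ i, a i ∂/∂x_i`. -/
def contractOmega (a : Fin n → MvPolynomial (Fin n) ℂ) (j : ℕ) : Omega n (j + 1) →ₗ[ℂ] Omega n j :=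
  ∑ i, mapOmega (LinearMap.mulLeft ℂ (a i)) (contractForm i j)

theorem contractOmega_form (a : Fin n → MvPolynomial (Fin n) ℂ) {j : ℕ}
    (g : MvPolynomial (Fin n) ℂ) (w : ⋀[ℂ]^(j + 1) (Fin n → ℂ)) :
    contractOmega a j (form g w) = ∑ i, form (a i * g) (contractForm i j w) := by
  simp [contractOmega, LinearMap.sum_apply, mapOmega_form]

theorem form_ite_smul {j : ℕ} (P : Prop) [Decidable P] (g : MvPolynomial (Fin n) ℂ)
    (w : ⋀[ℂ]^j (Fin n → ℂ)) :
    form g ((if P then (1 : ℂ) else 0) • w) = if P then form g w else 0 := by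
  split_ifs
  · rw [one_smul]
  · rw [zero_smul]; exact TensorProduct.tmul_zero _ _

theorem form_sub_right {j : ℕ} (g : MvPolynomial (Fin n) ℂ) (w w' : ⋀[ℂ]^j (Fin n → ℂ)) :
    form g (w - w') = form g w - form g w' :=
  TensorProduct.tmul_sub g w w'

/-- Contraction is an antiderivation, so the mixed terms `dx_k ∧ ι_i w` cancel and only the pairing
of `a` with `df` remains. This is the Koszul homotopy; its degree `0` case is separate since nothing
can be contracted there. -/
theorem contractOmega_wedgeOmega (a : Fin n → MvPolynomial (Fin n) ℂ)
    (f : MvPolynomial (Fin n) ℂ) {j : ℕ} (x : Omega n (j + 1)) :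
    contractOmega a (j + 1) (wedgeOmega f (j + 1) x) +
      wedgeOmega f j (contractOmega a j x) =
      mulOmega (∑ i, a i * MvPolynomial.pderiv i f) (j + 1) x := by
  induction x using Omega.induction with
  | zero => simp
  | add x y hx hy => simp only [map_add, ← hx, ← hy]; abel
  | form g w =>
    have h : ∑ k, ∑ i, form (a i * (MvPolynomial.pderiv k f * g))
        (dxWedge k j (contractForm i j w)) = ∑ i, ∑ k, form (MvPolynomial.pderiv k f * (a i * g))
        (dxWedge k j (contractForm i j w)) := by
      rw [Finset.sum_comm]
      refine Finset.sum_congr rfl fun i _ => Finset.sum_congr rfl fun k _ => ?_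
      congr 1
      ring
    simp only [wedgeOmega_form, contractOmega_form, map_sum, mulOmega_form, contractForm_dxWedge,
      form_sub_right, form_ite_smul, Finset.sum_sub_distrib, Finset.sum_mul, form_sum_left, h]
    simp [mul_assoc]

theorem contractOmega_wedgeOmega_zero (a : Fin n → MvPolynomial (Fin n) ℂ)
    (f : MvPolynomial (Fin n) ℂ) (x : Omega n 0) :
    contractOmega a 0 (wedgeOmega f 0 x) =
      mulOmega (∑ i, a i * MvPolynomial.pderiv i f) 0 x := by
  induction x using Omega.induction with
  | zero => simp
  | add x y hx hy => simp only [map_add, ← hx, ← hy]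
  | form g w =>
    simp only [wedgeOmega_form, contractOmega_form, map_sum, mulOmega_form,
      contractForm_dxWedge_zero, form_ite_smul, Finset.sum_mul, form_sum_left]
    simp [mul_assoc]

/-- Cartan's formula for the Lie derivative along the Euler field: the eigenvalue adds the
coefficient degree and the form degree. It is nonzero in positive form degree, which yields explicit
primitives. -/
theorem lie_euler_form {j m : ℕ} {g : MvPolynomial (Fin n) ℂ} (hg : g.IsHomogeneous m)
    (w : ⋀[ℂ]^(j + 1) (Fin n → ℂ)) :
    contractOmega MvPolynomial.X (j + 1) (dOmega n (j + 1) (form g w)) +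
      dOmega n j (contractOmega MvPolynomial.X j (form g w)) =
      ((m + (j + 1) : ℕ) : ℂ) • form g w := by
  have h : ∑ k, ∑ i, form (MvPolynomial.X i * MvPolynomial.pderiv k g)
      (dxWedge k j (contractForm i j w)) = ∑ i, ∑ k, form (MvPolynomial.X i * MvPolynomial.pderiv k g)
      (dxWedge k j (contractForm i j w)) := Finset.sum_comm
  have h1 : ∑ i, form (MvPolynomial.X i * MvPolynomial.pderiv i g) w = (m : ℂ) • form g w := by
    rw [← form_sum_left, hg.sum_X_mul_pderiv, ← Nat.cast_smul_eq_nsmul ℂ, form_smul]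
  have h2 : ∑ i, form g (dxWedge i j (contractForm i j w)) = ((j + 1 : ℕ) : ℂ) • form g w := by
    rw [← form_sum_right, sum_dxWedge_contractForm, form_smul_right]
  have h3 : ∀ i k : Fin n, form (MvPolynomial.pderiv k (MvPolynomial.X i * g))
      (dxWedge k j (contractForm i j w)) =
      form (MvPolynomial.X i * MvPolynomial.pderiv k g) (dxWedge k j (contractForm i j w)) +
        if k = i then form g (dxWedge k j (contractForm i j w)) else 0 := by
    intro i k
    rw [Derivation.leibniz, MvPolynomial.pderiv_X, smul_eq_mul, smul_eq_mul, form_add]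
    by_cases hk : k = i
    · subst hk; simp
    · simp [hk, Ne.symm hk, form_zero_left]
  simp only [dOmega_form, contractOmega_form, map_sum, contractForm_dxWedge,
    form_sub_right, form_ite_smul, Finset.sum_sub_distrib, h, h3, Finset.sum_add_distrib,
    Finset.sum_ite_eq', Finset.mem_univ, if_true, h1, h2]
  rw [Nat.cast_add m (j + 1), add_smul]
  abel

theorem lie_euler_comp {j : ℕ} (m : ℕ) (x : Omega n (j + 1)) :
    contractOmega MvPolynomial.X (j + 1) (dOmega n (j + 1) (comp m (j + 1) x)) +
      dOmega n j (contractOmega MvPolynomial.X j (comp m (j + 1) x)) =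
      ((m + (j + 1) : ℕ) : ℂ) • comp m (j + 1) x := by
  induction x using Omega.induction with
  | zero => simp
  | add x y hx hy => simp only [map_add, smul_add, ← hx, ← hy]; abel
  | form g w =>
    rw [comp_form]
    exact lie_euler_form (MvPolynomial.homogeneousComponent_isHomogeneous m g) w

/-- The algebraic Poincaré lemma. -/
theorem exists_dOmega_eq {j : ℕ} {x : Omega n (j + 1)} (hx : dOmega n (j + 1) x = 0) :
    ∃ y, dOmega n j y = x := by
  refine mem_of_comp_mem (LinearMap.range (dOmega n j)) fun m => ?_
  have h0 : dOmega n (j + 1) (comp m (j + 1) x) = 0 := by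
    cases m with
    | zero => exact dOmega_comp_zero x
    | succ m => rw [dOmega_comp_succ, hx, map_zero]
  have h := lie_euler_comp m x
  rw [h0, map_zero, zero_add] at h
  refine ⟨((m + (j + 1) : ℕ) : ℂ)⁻¹ • contractOmega MvPolynomial.X j (comp m (j + 1) x), ?_⟩
  rw [map_smul, h, smul_smul, inv_mul_cancel₀, one_smul]
  exact Nat.cast_ne_zero.2 (by omega)

theorem Omega_eq_zero {j : ℕ} (h : n < j) (x : Omega n j) : x = 0 := by
  have h0 : Subsingleton (⋀[ℂ]^j (Fin n → ℂ)) := by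
    rw [← Module.finrank_eq_zero_iff_of_free (R := ℂ), exteriorPower.finrank_eq]
    simp [Nat.choose_eq_zero_of_lt h]
  induction x using Omega.induction with
  | zero => rfl
  | add x y hx hy => rw [hx, hy, add_zero]
  | form g w => rw [Subsingleton.elim w 0]; exact TensorProduct.tmul_zero _ _

end GaussManin
end

/-! ### Degeneration at `E_2` in terms of chains -/

noncomputable section

namespace FilteredComplex

variable {k : Type} [CommRing k] (C : FilteredComplex k)

theorem dE_eq_zero_iff (r p : ℤ) (j : ℕ) :
    C.dE r p j = 0 ↔ ∀ x ∈ C.Z r p j, (C.K.d j (j + 1)).hom x ∈ C.B r (p + r) (j + 1) := by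
  constructor
  · intro h x hx
    have h1 : C.dE r p j (Submodule.Quotient.mk ⟨x, hx⟩) = 0 := by rw [h]; rfl
    have h2 : C.dZ r p j ⟨x, hx⟩ ∈ (C.B r (p + r) (j + 1)).submoduleOf (C.Z r (p + r) (j + 1)) :=
      (Submodule.Quotient.mk_eq_zero _).1 h1
    exact h2
  · intro h
    refine LinearMap.ext fun y => ?_
    obtain ⟨x, rfl⟩ := Submodule.Quotient.mk_surjective _ y
    exact (Submodule.Quotient.mk_eq_zero _).2 (h x.1 x.2)

theorem mem_B_succ_iff (r p : ℤ) (j : ℕ) (x : C.K.X (j + 1)) :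
    x ∈ C.B r p (j + 1) ↔ ∃ z ∈ C.Z (r - 1) (p + 1) (j + 1), ∃ y ∈ C.Z (r - 1) (p - r + 1) j,
      z + (C.K.d j (j + 1)).hom y = x := by
  have h : ⨆ i : ℕ, (C.Z (r - 1) (p - r + 1) i).map (C.K.d i (j + 1)).hom =
      (C.Z (r - 1) (p - r + 1) j).map (C.K.d j (j + 1)).hom := by
    refine le_antisymm (iSup_le fun i => ?_) (le_iSup (fun i =>
      (C.Z (r - 1) (p - r + 1) i).map (C.K.d i (j + 1)).hom) j)
    by_cases hi : i = j
    · rw [hi]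
    · rintro _ ⟨y, -, rfl⟩
      rw [C.K.shape i (j + 1) (fun h => hi (Nat.succ_injective h))]
      exact Submodule.zero_mem _
  rw [B, h, Submodule.mem_sup]
  simp only [Submodule.mem_map, exists_exists_and_eq_and]

end FilteredComplex

namespace GaussManin

variable {n : ℕ}

/-- The leading forms of chains `η_k, …, η_0` with `df ∧ η_k = 0` and `d η_{i+1} = df ∧ η_i`. -/
def chainEnd (f : MvPolynomial (Fin n) ℂ) (j : ℕ) : ℕ → Submodule ℂ (Omega n j)
  | 0 => A f j
  | k + 1 => ((chainEnd f j k).map (dOmega n j)).comap (wedgeOmega f j)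

theorem mem_chainEnd_zero {f : MvPolynomial (Fin n) ℂ} {j : ℕ} {x : Omega n j} :
    x ∈ chainEnd f j 0 ↔ wedgeOmega f j x = 0 :=
  Iff.rfl

theorem mem_chainEnd_succ {f : MvPolynomial (Fin n) ℂ} {j k : ℕ} {x : Omega n j} :
    x ∈ chainEnd f j (k + 1) ↔ ∃ y ∈ chainEnd f j k, dOmega n j y = wedgeOmega f j x :=
  Iff.rfl

section

variable {ι : Type}

theorem mem_poleFiltration {ord : ι → ℤ} {p : ℤ} {j : ℕ} {x : ι →₀ Omega n j} :
    x ∈ poleFiltration ι ord n p j ↔ ∀ i, (j : ℤ) - p < ord i → x i = 0 := by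
  rw [poleFiltration, Finsupp.mem_supported']
  simp only [Set.mem_ofPred_eq, not_le]

variable [AddCommMonoidWithOne ι]

theorem gmD_apply_succ (hinj : ∀ i i' : ι, i + 1 = i' + 1 → i = i')
    (f : MvPolynomial (Fin n) ℂ) (j : ℕ) (x : ι →₀ Omega n j) (i : ι) :
    gmD ι f j x (i + 1) = dOmega n j (x (i + 1)) - wedgeOmega f j (x i) := by
  classical
  induction x using Finsupp.induction_linear with
  | zero => simp
  | add x y hx hy => simp only [map_add, Finsupp.add_apply, hx, hy]; abel
  | single i' w =>
    have h : (i' + 1 = i + 1) = (i' = i) := propext ⟨hinj _ _, fun h => by rw [h]⟩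
    simp only [gmD_single, Finsupp.sub_apply, Finsupp.single_apply, h]
    split_ifs <;> simp

theorem gmD_apply_of_forall_ne (f : MvPolynomial (Fin n) ℂ) (j : ℕ) (x : ι →₀ Omega n j) (i : ι)
    (hi : ∀ i', i' + 1 ≠ i) : gmD ι f j x i = dOmega n j (x i) := by
  classical
  induction x using Finsupp.induction_linear with
  | zero => simp
  | add x y hx hy => simp only [map_add, Finsupp.add_apply, hx, hy]
  | single i' w =>
    simp only [gmD_single, Finsupp.sub_apply, Finsupp.single_apply, hi i', if_false, sub_zero]
    split_ifs <;> simp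

variable {ord : ι → ℤ}

theorem add_one_cancel (hord : ∀ i, ord (i + 1) = ord i + 1) (hinj : Function.Injective ord)
    (i i' : ι) (h : i + 1 = i' + 1) : i = i' :=
  hinj (by have := congrArg ord h; rw [hord, hord] at this; omega)

theorem gmFiltered_d (hord : ∀ i, ord (i + 1) = ord i + 1)
    (f : MvPolynomial (Fin n) ℂ) (j : ℕ) (x : ι →₀ Omega n j) :
    ((gmFiltered ι ord hord f).K.d j (j + 1)).hom x = gmD ι f j x := by
  have e : (gmComplex ι f).d j (j + 1) = ModuleCat.ofHom (gmD ι f j) :=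
    CochainComplex.of_d (fun j => ModuleCat.of ℂ (ι →₀ Omega n j))
      (fun j => ModuleCat.ofHom (gmD ι f j)) j
  change ((gmComplex ι f).d j (j + 1)).hom x = _
  rw [e]
  rfl

theorem mem_gmFiltered_Z (hord : ∀ i, ord (i + 1) = ord i + 1)
    {f : MvPolynomial (Fin n) ℂ} {r p : ℤ} {j : ℕ} {x : ι →₀ Omega n j} :
    x ∈ (gmFiltered ι ord hord f).Z r p j ↔ (∀ i, (j : ℤ) - p < ord i → x i = 0) ∧
      ∀ i, (j : ℤ) + 1 - (p + r) < ord i → gmD ι f j x i = 0 := by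
  have h : x ∈ (gmFiltered ι ord hord f).Z r p j ↔ x ∈ poleFiltration ι ord n p j ∧
      gmD ι f j x ∈ poleFiltration ι ord n (p + r) (j + 1) := by
    rw [← gmFiltered_d hord]
    rfl
  rw [h, mem_poleFiltration, mem_poleFiltration, Nat.cast_succ]

/-- When `dx = z + dy`, the element `z = dx - dy` is automatically closed, so the only condition on
it is its order. As `dx` and `dy` already vanish above order `j + 1 - (p + r)`, this means that they
agree at that one order. -/
theorem gmFiltered_dE_eq_zero_iff (hord : ∀ i, ord (i + 1) = ord i + 1)
    (f : MvPolynomial (Fin n) ℂ) (r p : ℤ) (j : ℕ) :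
    (gmFiltered ι ord hord f).dE r p j = 0 ↔ ∀ x : ι →₀ Omega n j,
      (∀ i, (j : ℤ) - p < ord i → x i = 0) →
      (∀ i, (j : ℤ) + 1 - (p + r) < ord i → gmD ι f j x i = 0) →
      ∃ y : ι →₀ Omega n j, (∀ i, (j : ℤ) - p - 1 < ord i → y i = 0) ∧
        (∀ i, (j : ℤ) + 1 - (p + r) < ord i → gmD ι f j y i = 0) ∧
        ∀ i, (j : ℤ) + 1 - (p + r) = ord i → gmD ι f j y i = gmD ι f j x i := by
  rw [FilteredComplex.dE_eq_zero_iff]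
  constructor
  · intro h x hx hdx
    obtain ⟨(z : ι →₀ Omega n (j + 1)), hz, y, hy, hzy⟩ :=
      (FilteredComplex.mem_B_succ_iff _ _ _ _ _).1 (h x ((mem_gmFiltered_Z hord).2 ⟨hx, hdx⟩))
    have hz := ((mem_gmFiltered_Z hord).1 hz).1
    have hy := (mem_gmFiltered_Z hord).1 hy
    refine ⟨y, fun i hi => hy.1 i (by omega), fun i hi => hy.2 i (by omega), fun i hi => ?_⟩
    have hi' := DFunLike.congr_fun (F := ι →₀ Omega n (j + 1)) (((congrArg (fun u => z + u)
      (gmFiltered_d hord f j y).symm).trans hzy).trans (gmFiltered_d hord f j x)) i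
    have hzi : z i = 0 := hz i (by push_cast; omega)
    change z i + gmD ι f j y i = _ at hi'
    rwa [hzi, zero_add] at hi'
  · intro h x hx
    obtain ⟨hx, hdx⟩ := (mem_gmFiltered_Z hord).1 hx
    obtain ⟨y, hy, hdy, hxy⟩ := h x hx hdx
    rw [FilteredComplex.mem_B_succ_iff]
    refine ⟨gmD ι f j x - gmD ι f j y, (mem_gmFiltered_Z hord).2 ⟨fun i hi => ?_, fun i _ => ?_⟩,
      y, (mem_gmFiltered_Z hord).2
        ⟨fun i hi => hy i (by omega), fun i hi => hdy i (by omega)⟩, ?_⟩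
    · change gmD ι f j x i - gmD ι f j y i = 0
      by_cases h1 : (j : ℤ) + 1 - (p + r) = ord i
      · rw [hxy i h1, sub_self]
      · push_cast at hi
        rw [hdx i (by omega), hdy i (by omega), sub_self]
    · have h0 := (map_sub (gmD ι f (j + 1)) (gmD ι f j x) (gmD ι f j y)).trans
        (congrArg₂ (· - ·) (gmD_gmD ι f j x) (gmD_gmD ι f j y))
      exact (DFunLike.congr_fun h0 i).trans (sub_self _)
    · exact (congrArg (fun u => gmD ι f j x - gmD ι f j y + u) (gmFiltered_d hord f j y)).trans
        ((sub_add_cancel _ _).trans (gmFiltered_d hord f j x).symm)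

/-- The coefficients of an element with differential of low order are ends of chains. -/
theorem apply_mem_chainEnd (hord : ∀ i, ord (i + 1) = ord i + 1)
    (hinj : Function.Injective ord) {f : MvPolynomial (Fin n) ℂ} {j : ℕ} {x : ι →₀ Omega n j} {m q : ℤ}
    (hx : ∀ i, m < ord i → x i = 0) (hdx : ∀ i, q < ord i → gmD ι f j x i = 0) (k : ℕ) (i : ι)
    (hi : ord i + k = m) (hqi : q ≤ ord i) : x i ∈ chainEnd f j k := by
  have h1 := fun i (h : q ≤ ord i) => (gmD_apply_succ (add_one_cancel hord hinj) f j x i).symm.trans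
    (hdx (i + 1) (by rw [hord]; omega))
  induction k generalizing i with
  | zero =>
    have h2 := h1 i hqi
    rw [hx (i + 1) (by rw [hord]; push_cast at hi; omega), map_zero, zero_sub, neg_eq_zero] at h2
    exact h2
  | succ k ih =>
    exact ⟨x (i + 1), ih (i + 1) (by rw [hord]; push_cast at hi; omega) (by rw [hord]; omega),
      sub_eq_zero.1 (h1 i hqi)⟩

/-- Placing the forms of the chain at consecutive exponents from `i` upwards makes all terms of the
differential telescope, except `dw`. -/
theorem exists_of_mem_chainEnd (hord : ∀ i, ord (i + 1) = ord i + 1)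
    {f : MvPolynomial (Fin n) ℂ} {j k : ℕ} {w : Omega n j}
    (hw : w ∈ chainEnd f j k) (i : ι) :
    ∃ x : ι →₀ Omega n j, (∀ i', ord i + k < ord i' → x i' = 0) ∧
      gmD ι f j x = Finsupp.single i (dOmega n j w) := by
  induction k generalizing w i with
  | zero =>
    refine ⟨Finsupp.single i w, fun i' hi' => ?_, ?_⟩
    · refine Finsupp.single_eq_of_ne ?_
      rintro rfl
      simp at hi'
    · rw [gmD_single, mem_chainEnd_zero.1 hw, Finsupp.single_zero, sub_zero]
  | succ k ih =>
    obtain ⟨y, hy, hyw⟩ := mem_chainEnd_succ.1 hw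
    obtain ⟨x, hx, hdx⟩ := ih hy (i + 1)
    refine ⟨Finsupp.single i w + x, fun i' hi' => ?_, ?_⟩
    · rw [Finsupp.add_apply, hx i' (by rw [hord]; push_cast at hi'; omega), add_zero]
      refine Finsupp.single_eq_of_ne ?_
      rintro rfl
      push_cast at hi'
      omega
    · rw [map_add, hdx, gmD_single, hyw]
      abel

/-- The submodule by which the component `Ω^{j+1} ∂_t^i` is divided in the `E_2`-term. -/
def boundaryTwo (ι : Type) [AddCommMonoidWithOne ι] (f : MvPolynomial (Fin n) ℂ) (j : ℕ) (i : ι) :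
    Submodule ℂ (Omega n (j + 1)) :=
  (A f j).map (dOmega n j) ⊔
    ⨆ (i' : ι) (_ : i' + 1 = i), LinearMap.range (wedgeOmega f j)

theorem gmD_apply_sub_mem_boundaryTwo (hinj : ∀ i i' : ι, i + 1 = i' + 1 → i = i')
    (f : MvPolynomial (Fin n) ℂ) (j : ℕ) (x : ι →₀ Omega n j) (i : ι) :
    gmD ι f j x i - dOmega n j (x i) ∈ boundaryTwo ι f j i := by
  by_cases hi : ∃ i', i' + 1 = i
  · obtain ⟨i', rfl⟩ := hi
    rw [gmD_apply_succ hinj, sub_sub_cancel_left]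
    exact Submodule.neg_mem _ (Submodule.mem_sup_right (Submodule.mem_iSup_of_mem i'
      (Submodule.mem_iSup_of_mem rfl ⟨_, rfl⟩)))
  · rw [gmD_apply_of_forall_ne f j x i (not_exists.1 hi), sub_self]
    exact Submodule.zero_mem _

/-- An element of `A` is placed at order `i`; a form `df ∧ b` comes from `-b` one order lower. -/
theorem exists_of_mem_boundaryTwo (hord : ∀ i, ord (i + 1) = ord i + 1)
    {f : MvPolynomial (Fin n) ℂ} {j : ℕ} {i : ι} {c : Omega n (j + 1)}
    (hc : c ∈ boundaryTwo ι f j i) :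
    ∃ y : ι →₀ Omega n j, (∀ i', ord i < ord i' → y i' = 0) ∧
      (∀ i', ord i < ord i' → gmD ι f j y i' = 0) ∧ gmD ι f j y i = c := by
  let W : Submodule ℂ (ι →₀ Omega n j) :=
    Finsupp.supported (Omega n j) ℂ {i' | ord i' ≤ ord i} ⊓
      (Finsupp.supported (Omega n (j + 1)) ℂ {i' | ord i' ≤ ord i}).comap (gmD ι f j)
  suffices h : boundaryTwo ι f j i ≤ W.map (Finsupp.lapply i ∘ₗ gmD ι f j) by
    obtain ⟨y, ⟨hy, hdy⟩, rfl⟩ := h hc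
    refine ⟨y, fun i' hi' => ?_, fun i' hi' => ?_, rfl⟩
    · exact (Finsupp.mem_supported' ℂ y).1 hy i' (not_le.2 hi')
    · exact (Finsupp.mem_supported' ℂ _).1 hdy i' (not_le.2 hi')
  refine sup_le ?_ (iSup_le fun i' => iSup_le fun hi' => ?_)
  · rintro _ ⟨a, ha, rfl⟩
    have hd : gmD ι f j (Finsupp.single i a) = Finsupp.single i (dOmega n j a) := by
      rw [gmD_single, show wedgeOmega f j a = 0 from ha, Finsupp.single_zero, sub_zero]
    have hi : i ∈ {i' | ord i' ≤ ord i} := le_refl (ord i)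
    refine ⟨Finsupp.single i a, ⟨Finsupp.single_mem_supported ℂ _ hi, ?_⟩, ?_⟩
    · rw [Submodule.comap_coe, Set.mem_preimage, hd]
      exact Finsupp.single_mem_supported ℂ _ hi
    · rw [LinearMap.comp_apply, hd, Finsupp.lapply_apply, Finsupp.single_eq_same]
  · rintro _ ⟨b, rfl⟩
    subst hi'
    have hne : i' ≠ i' + 1 := fun h => by have := congrArg ord h; rw [hord] at this; omega
    have hle : ord i' ≤ ord (i' + 1) := by rw [hord]; omega
    refine ⟨Finsupp.single i' (-b), ⟨Finsupp.single_mem_supported ℂ _ hle, ?_⟩, ?_⟩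
    · rw [Submodule.comap_coe, Set.mem_preimage, gmD_single]
      exact Submodule.sub_mem _ (Finsupp.single_mem_supported ℂ _ hle)
        (Finsupp.single_mem_supported ℂ _ (le_refl (ord (i' + 1))))
    · rw [LinearMap.comp_apply, gmD_single, Finsupp.lapply_apply, Finsupp.sub_apply,
        Finsupp.single_eq_same, Finsupp.single_eq_of_ne hne.symm, map_neg, zero_sub, neg_neg]

/-- A chain realizes `dw` as the leading coefficient of a differential. The vanishing of `d_{k+2}`
replaces that chain by one with one form fewer, at the cost of a term `df ∧ b`, so induction on the
length applies. -/
theorem map_chainEnd_le_boundaryTwo (hord : ∀ i, ord (i + 1) = ord i + 1)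
    (hinj : Function.Injective ord) {f : MvPolynomial (Fin n) ℂ}
    (h : (gmFiltered ι ord hord f).DegeneratesAt 2) (j k : ℕ) (i : ι) :
    (chainEnd f j k).map (dOmega n j) ≤ boundaryTwo ι f j i := by
  induction k with
  | zero => exact le_sup_left
  | succ k ih =>
    rintro _ ⟨w, hw, rfl⟩
    obtain ⟨x, hx, hdx⟩ := exists_of_mem_chainEnd hord hw i
    push_cast at hx
    have hdx' : ∀ i', ord i < ord i' → gmD ι f j x i' = 0 := fun i' hi' => by
      rw [hdx, Finsupp.single_eq_of_ne]
      rintro rfl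
      omega
    -- With `r = k + 2` and `p = j - (ord i + k + 1)`, the order `j + 1 - (p + r)` is `ord i`, while
    -- `y` may only reach order `ord i + k`.
    obtain ⟨y, hy, hdy, hxy⟩ := (gmFiltered_dE_eq_zero_iff hord f (k + 2)
      (j - (ord i + (k + 1))) j).1 (h _ (by omega) _ _) x (fun i' hi' => hx i' (by omega))
      (fun i' hi' => hdx' i' (by omega))
    have hi := hxy i (by omega)
    rw [hdx, Finsupp.single_eq_same] at hi
    have hyi := apply_mem_chainEnd hord hinj (m := ord i + k) (q := ord i)
      (fun i' hi' => hy i' (by omega)) (fun i' hi' => hdy i' (by omega)) k i rfl le_rfl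
    change dOmega n j w ∈ _
    rw [← hi, ← sub_add_cancel (gmD ι f j y i) (dOmega n j (y i))]
    exact Submodule.add_mem _
      (gmD_apply_sub_mem_boundaryTwo (add_one_cancel hord hinj) f j y i)
      (ih (Submodule.mem_map_of_mem hyi))

theorem degeneratesAt_two_iff (hord : ∀ i, ord (i + 1) = ord i + 1)
    (hinj : Function.Injective ord) (f : MvPolynomial (Fin n) ℂ) :
    (gmFiltered ι ord hord f).DegeneratesAt 2 ↔
      ∀ (j k : ℕ) (i : ι), (chainEnd f j k).map (dOmega n j) ≤ boundaryTwo ι f j i := by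
  classical
  refine ⟨fun h j k i => map_chainEnd_le_boundaryTwo hord hinj h j k i, fun h s hs p j => ?_⟩
  rw [gmFiltered_dE_eq_zero_iff]
  intro x hx hdx
  by_cases hi : ∃ i, ord i = (j : ℤ) + 1 - (p + s)
  · obtain ⟨i, hi⟩ := hi
    -- The order drops from `j - p` to `j + 1 - (p + s)`, that is, by `s - 1`.
    have hxi := apply_mem_chainEnd hord hinj hx hdx (s - 1).toNat i (by omega) hi.ge
    obtain ⟨y, hy, hdy, hyi⟩ := exists_of_mem_boundaryTwo hord
      (h j _ i (Submodule.mem_map_of_mem hxi))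
    have hlow : ∀ i', ord i < ord i' →
        gmD ι f j (x.filter fun i' => ord i' < ord i) i' = 0 := by
      intro i' hi'
      by_cases hs : ∃ a, a + 1 = i'
      · obtain ⟨a, rfl⟩ := hs
        have ha := hord a
        rw [gmD_apply_succ (add_one_cancel hord hinj), Finsupp.filter_apply_neg _ _ (by omega),
          Finsupp.filter_apply_neg _ _ (by omega), map_zero, map_zero, sub_zero]
      · rw [gmD_apply_of_forall_ne f j _ i' (not_exists.1 hs),
          Finsupp.filter_apply_neg _ _ (by omega), map_zero]
    -- The element `y` accounts for `d x_i`. The part of `x` of order below `ord i` supplies the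
    -- remaining `-df ∧ x_{i-1}`. Since `s ≥ 2`, both have order at most `j - p - 1`.
    refine ⟨y + x.filter fun i' => ord i' < ord i, fun i' hi' => ?_, fun i' hi' => ?_,
      fun i' hi' => ?_⟩
    · rw [Finsupp.add_apply, hy i' (by omega), Finsupp.filter_apply_neg _ _ (by omega), add_zero]
    · rw [map_add, Finsupp.add_apply, hdy i' (by omega), hlow i' (by omega), add_zero]
    · obtain rfl := hinj (hi'.symm.trans hi.symm)
      rw [map_add, Finsupp.add_apply, hyi]
      by_cases hs : ∃ a, a + 1 = i'
      · obtain ⟨a, rfl⟩ := hs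
        have ha := hord a
        rw [gmD_apply_succ (add_one_cancel hord hinj), gmD_apply_succ (add_one_cancel hord hinj),
          Finsupp.filter_apply_neg _ _ (by omega), Finsupp.filter_apply_pos _ _ (by omega),
          map_zero, zero_sub, sub_eq_add_neg]
      · rw [gmD_apply_of_forall_ne f j _ i' (not_exists.1 hs),
          gmD_apply_of_forall_ne f j _ i' (not_exists.1 hs),
          Finsupp.filter_apply_neg _ _ (by omega), map_zero, add_zero]
  -- No exponent has the critical order, so there is no coefficient to match.
  · refine ⟨0, fun i _ => rfl, fun i _ => ?_, fun i h1 => (hi ⟨i, h1.symm⟩).elim⟩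
    rw [map_zero, Finsupp.zero_apply]

end

/-! ### The ordinary and the microlocal criterion -/

theorem boundaryTwo_nat_zero (f : MvPolynomial (Fin n) ℂ) (j : ℕ) :
    boundaryTwo ℕ f j 0 = (A f j).map (dOmega n j) := by
  simp [boundaryTwo]

theorem boundaryTwo_int (f : MvPolynomial (Fin n) ℂ) (j : ℕ) (i : ℤ) :
    boundaryTwo ℤ f j i = (A f j).map (dOmega n j) ⊔ LinearMap.range (wedgeOmega f j) := by
  have h : ∀ i' : ℤ, i' + 1 = i ↔ i' = i - 1 := fun i' => by omega
  simp [boundaryTwo, h]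

theorem gaussManin_degeneratesAt_two_iff (f : MvPolynomial (Fin n) ℂ) :
    (gaussManin f).DegeneratesAt 2 ↔
      ∀ j k, (chainEnd f j k).map (dOmega n j) ≤ (A f j).map (dOmega n j) := by
  rw [gaussManin, degeneratesAt_two_iff _ Nat.cast_injective]
  refine ⟨fun h j k => ?_, fun h j k i => (h j k).trans le_sup_left⟩
  rw [← boundaryTwo_nat_zero]
  exact h j k 0

theorem microlocalGaussManin_degeneratesAt_two_iff (f : MvPolynomial (Fin n) ℂ) :
    (microlocalGaussManin f).DegeneratesAt 2 ↔
      ∀ j k, (chainEnd f j k).map (dOmega n j) ≤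
        (A f j).map (dOmega n j) ⊔ LinearMap.range (wedgeOmega f j) := by
  rw [microlocalGaussManin, degeneratesAt_two_iff _ fun _ _ h => h]
  simp only [boundaryTwo_int]
  exact ⟨fun h j k => h j k 0, fun h j k _ => h j k⟩

/-! ### Forms with coefficients in an ideal -/

/-- The coefficient of a form with respect to a linear functional on the exterior power. -/
def evalForm {j : ℕ} (φ : ⋀[ℂ]^j (Fin n → ℂ) →ₗ[ℂ] ℂ) : Omega n j →ₗ[ℂ] MvPolynomial (Fin n) ℂ :=
  (TensorProduct.rid ℂ (MvPolynomial (Fin n) ℂ)).toLinearMap ∘ₗ TensorProduct.map LinearMap.id φ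

theorem evalForm_form {j : ℕ} (φ : ⋀[ℂ]^j (Fin n → ℂ) →ₗ[ℂ] ℂ) (g : MvPolynomial (Fin n) ℂ)
    (w : ⋀[ℂ]^j (Fin n → ℂ)) : evalForm φ (form g w) = φ w • g :=
  rfl

theorem evalForm_mapOmega {j l : ℕ} (φ : ⋀[ℂ]^l (Fin n → ℂ) →ₗ[ℂ] ℂ) (a : MvPolynomial (Fin n) ℂ)
    (L : ⋀[ℂ]^j (Fin n → ℂ) →ₗ[ℂ] ⋀[ℂ]^l (Fin n → ℂ)) (x : Omega n j) :
    evalForm φ (mapOmega (LinearMap.mulLeft ℂ a) L x) = a * evalForm (φ ∘ₗ L) x := by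
  induction x using Omega.induction with
  | zero => simp
  | add x y hx hy => simp only [map_add, hx, hy, mul_add]
  | form g w => simp [mapOmega_form, evalForm_form]

/-- The forms with coefficients in the ideal `I`. -/
def idealForms (I : Ideal (MvPolynomial (Fin n) ℂ)) (j : ℕ) : Submodule ℂ (Omega n j) :=
  ⨅ φ : ⋀[ℂ]^j (Fin n → ℂ) →ₗ[ℂ] ℂ, (I.restrictScalars ℂ).comap (evalForm φ)

theorem mem_idealForms {I : Ideal (MvPolynomial (Fin n) ℂ)} {j : ℕ} {x : Omega n j} :
    x ∈ idealForms I j ↔ ∀ φ, evalForm φ x ∈ I := by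
  simp [idealForms]

theorem mapOmega_mem_idealForms {I : Ideal (MvPolynomial (Fin n) ℂ)} {j l : ℕ}
    (a : MvPolynomial (Fin n) ℂ) (L : ⋀[ℂ]^j (Fin n → ℂ) →ₗ[ℂ] ⋀[ℂ]^l (Fin n → ℂ)) {x : Omega n j}
    (hx : x ∈ idealForms I j) : mapOmega (LinearMap.mulLeft ℂ a) L x ∈ idealForms I l :=
  mem_idealForms.2 fun φ => by
    rw [evalForm_mapOmega]
    exact I.mul_mem_left _ (mem_idealForms.1 hx _)

theorem wedgeOmega_mem_idealForms {I : Ideal (MvPolynomial (Fin n) ℂ)} {j : ℕ}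
    (f : MvPolynomial (Fin n) ℂ) {x : Omega n j} (hx : x ∈ idealForms I j) :
    wedgeOmega f j x ∈ idealForms I (j + 1) := by
  rw [wedgeOmega, LinearMap.sum_apply]
  exact Submodule.sum_mem _ fun i _ => mapOmega_mem_idealForms _ _ hx

theorem contractOmega_mem_idealForms {I : Ideal (MvPolynomial (Fin n) ℂ)} {j : ℕ}
    (a : Fin n → MvPolynomial (Fin n) ℂ) {x : Omega n (j + 1)} (hx : x ∈ idealForms I (j + 1)) :
    contractOmega a j x ∈ idealForms I j := by
  rw [contractOmega, LinearMap.sum_apply]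
  exact Submodule.sum_mem _ fun i _ => mapOmega_mem_idealForms _ _ hx

theorem evalForm_mulOmega {j : ℕ} (φ : ⋀[ℂ]^j (Fin n → ℂ) →ₗ[ℂ] ℂ) (a : MvPolynomial (Fin n) ℂ)
    (x : Omega n j) : evalForm φ (mulOmega a j x) = a * evalForm φ x :=
  evalForm_mapOmega φ a LinearMap.id x

theorem mulOmega_mem_idealForms {I : Ideal (MvPolynomial (Fin n) ℂ)} {j : ℕ}
    {a : MvPolynomial (Fin n) ℂ} (ha : a ∈ I) (x : Omega n j) :
    mulOmega a j x ∈ idealForms I j :=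
  mem_idealForms.2 fun φ => by
    rw [evalForm_mulOmega]
    exact I.mul_mem_right _ ha

theorem mem_idealForms_of_mulOmega_mem {I : Ideal (MvPolynomial (Fin n) ℂ)} {j : ℕ}
    {a : MvPolynomial (Fin n) ℂ} (ha : ∀ g, a * g ∈ I → g ∈ I) {x : Omega n j}
    (hx : mulOmega a j x ∈ idealForms I j) : x ∈ idealForms I j :=
  mem_idealForms.2 fun φ => ha _ (by
    rw [← evalForm_mulOmega]
    exact mem_idealForms.1 hx φ)

theorem idealForms_mono {I I' : Ideal (MvPolynomial (Fin n) ℂ)} (h : I ≤ I') (j : ℕ) :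
    idealForms I j ≤ idealForms I' j :=
  fun _ hx => mem_idealForms.2 fun φ => h (mem_idealForms.1 hx φ)

theorem sum_form_evalForm {j : ℕ} {α : Type*} [Fintype α] (b : Module.Basis α ℂ (⋀[ℂ]^j (Fin n → ℂ)))
    (x : Omega n j) : ∑ i, form (evalForm (b.coord i) x) (b i) = x := by
  induction x using Omega.induction with
  | zero => simp [form_zero_left]
  | add x y hx hy => simp only [map_add, form_add, Finset.sum_add_distrib, hx, hy]
  | form g w =>
    simp only [evalForm_form, form_smul, ← form_smul_right, Module.Basis.coord_apply]
    rw [← form_sum_right, b.sum_repr]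

theorem eq_zero_of_mem_idealForms_bot {j : ℕ} {x : Omega n j} (hx : x ∈ idealForms ⊥ j) : x = 0 := by
  rw [← sum_form_evalForm (Module.finBasis ℂ _) x]
  refine Finset.sum_eq_zero fun i _ => ?_
  rw [show evalForm _ x = 0 from mem_idealForms.1 hx _, form_zero_left]

theorem form_mem_idealForms {I : Ideal (MvPolynomial (Fin n) ℂ)} {j : ℕ} {g : MvPolynomial (Fin n) ℂ}
    (hg : g ∈ I) (w : ⋀[ℂ]^j (Fin n → ℂ)) : form g w ∈ idealForms I j :=
  mem_idealForms.2 fun φ => by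
    rw [evalForm_form, MvPolynomial.smul_eq_C_mul]
    exact I.mul_mem_left _ hg

theorem exists_of_mem_idealForms_sup {I : Ideal (MvPolynomial (Fin n) ℂ)}
    {a : MvPolynomial (Fin n) ℂ} {j : ℕ} {x : Omega n j}
    (hx : x ∈ idealForms (I ⊔ Ideal.span {a}) j) :
    ∃ u ∈ idealForms I j, ∃ v, x = u + mulOmega a j v := by
  let b := Module.finBasis ℂ (⋀[ℂ]^j (Fin n → ℂ))
  have h : ∀ i, ∃ g ∈ I, ∃ v, evalForm (b.coord i) x = g + a * v := by
    intro i
    obtain ⟨g, hg, v, hv, e⟩ := Submodule.mem_sup.1 (mem_idealForms.1 hx (b.coord i))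
    obtain ⟨c, rfl⟩ := Ideal.mem_span_singleton'.1 hv
    exact ⟨g, hg, c, by rw [← e, mul_comm]⟩
  choose g hg v hv using h
  refine ⟨∑ i, form (g i) (b i), Submodule.sum_mem _ fun i _ => form_mem_idealForms (hg i) _,
    ∑ i, form (v i) (b i), ?_⟩
  conv_lhs => rw [← sum_form_evalForm b x]
  rw [map_sum, ← Finset.sum_add_distrib]
  exact Finset.sum_congr rfl fun i _ => by rw [hv, form_add, mulOmega_form]

/-! ### Exactness of the Koszul complex -/

/-- The image of `df ∧` in degree `j`. -/
def koszulBoundary (f : MvPolynomial (Fin n) ℂ) : ∀ j, Submodule ℂ (Omega n j)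
  | 0 => ⊥
  | j + 1 => LinearMap.range (wedgeOmega f j)

theorem wedgeOmega_eq_zero_of_mem {f : MvPolynomial (Fin n) ℂ} {j : ℕ} {x : Omega n j}
    (hx : x ∈ koszulBoundary f j) : wedgeOmega f j x = 0 := by
  cases j with
  | zero => rw [(Submodule.mem_bot ℂ).1 hx, map_zero]
  | succ j =>
    obtain ⟨y, rfl⟩ := hx
    exact wedgeOmega_wedgeOmega f y

theorem mulOmega_mem_koszulBoundary {f : MvPolynomial (Fin n) ℂ} (a : MvPolynomial (Fin n) ℂ) {j : ℕ}
    {x : Omega n j} (hx : x ∈ koszulBoundary f j) : mulOmega a j x ∈ koszulBoundary f j := by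
  cases j with
  | zero =>
    rw [(Submodule.mem_bot ℂ).1 hx, map_zero]
    exact Submodule.zero_mem _
  | succ j =>
    obtain ⟨y, rfl⟩ := hx
    exact ⟨mulOmega a j y, wedgeOmega_mulOmega f a y⟩

theorem comp_mem_koszulBoundary {f : MvPolynomial (Fin n) ℂ} {d : ℕ} (hf : f.IsHomogeneous d) (m : ℕ)
    {j : ℕ} {x : Omega n j} (hx : x ∈ koszulBoundary f j) : comp m j x ∈ koszulBoundary f j := by
  cases j with
  | zero =>
    rw [(Submodule.mem_bot ℂ).1 hx, map_zero]
    exact Submodule.zero_mem _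
  | succ j =>
    obtain ⟨y, rfl⟩ := hx
    rw [comp_wedgeOmega hf]
    split_ifs
    · exact ⟨_, rfl⟩
    · exact Submodule.zero_mem _

/-- Exactness in degree `j` of the Koszul complex of the partial derivatives of `f`, modulo `I`. -/
def KoszulExactMod (f : MvPolynomial (Fin n) ℂ) (I : Ideal (MvPolynomial (Fin n) ℂ)) (j : ℕ) : Prop :=
  ∀ x : Omega n j, wedgeOmega f j x ∈ idealForms I (j + 1) →
    x ∈ koszulBoundary f j ⊔ idealForms I j

/-- Contracting `df ∧ x` with `∑ c_i ∂/∂x_i` gives `a x` modulo `I`, and `a` is a nonzerodivisor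
modulo `I`. -/
theorem KoszulExactMod.zero {f : MvPolynomial (Fin n) ℂ} {I : Ideal (MvPolynomial (Fin n) ℂ)}
    {a : MvPolynomial (Fin n) ℂ} (c : Fin n → MvPolynomial (Fin n) ℂ)
    (hc : a - ∑ i, c i * MvPolynomial.pderiv i f ∈ I) (ha : ∀ g, a * g ∈ I → g ∈ I) :
    KoszulExactMod f I 0 := by
  intro x hx
  refine Submodule.mem_sup_right (mem_idealForms_of_mulOmega_mem ha (mem_idealForms.2 fun φ => ?_))
  have h := mem_idealForms.1 (contractOmega_mem_idealForms c hx) φ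
  rw [contractOmega_wedgeOmega_zero, evalForm_mulOmega] at h
  rw [evalForm_mulOmega]
  have h2 := I.add_mem (I.mul_mem_right (evalForm φ x) hc) h
  rwa [← add_mul, sub_add_cancel] at h2

/-- Modulo `I` the homotopy gives `a x ≡ df ∧ ιx`, so `ιx` is a cycle modulo `I + (a)`. Exactness
there writes `ιx` as a boundary plus `u' + a v` with `u'` in `I`. Hence `a (x - df ∧ v) ≡ 0`, and
`a` can be cancelled. -/
theorem KoszulExactMod.succ {f : MvPolynomial (Fin n) ℂ} {I : Ideal (MvPolynomial (Fin n) ℂ)}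
    {a : MvPolynomial (Fin n) ℂ} (c : Fin n → MvPolynomial (Fin n) ℂ)
    (hc : a - ∑ i, c i * MvPolynomial.pderiv i f ∈ I) (ha : ∀ g, a * g ∈ I → g ∈ I) {j : ℕ}
    (h : KoszulExactMod f (I ⊔ Ideal.span {a}) j) : KoszulExactMod f I (j + 1) := by
  intro x hx
  have h1 := contractOmega_wedgeOmega c f x
  have h2 := contractOmega_mem_idealForms c hx
  have h3 : mulOmega a (j + 1) x - mulOmega (∑ i, c i * MvPolynomial.pderiv i f) (j + 1) x ∈
      idealForms I (j + 1) := mem_idealForms.2 fun φ => by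
    rw [map_sub, evalForm_mulOmega, evalForm_mulOmega, ← sub_mul]
    exact I.mul_mem_right _ hc
  have h4 : mulOmega a (j + 1) x - wedgeOmega f j (contractOmega c j x) ∈
      idealForms I (j + 1) := by
    have := Submodule.add_mem _ h3 h2
    rw [← h1] at this
    convert this using 1
    abel
  have h5 : wedgeOmega f j (contractOmega c j x) ∈
      idealForms (I ⊔ Ideal.span {a}) (j + 1) := by
    have := Submodule.sub_mem _ (mulOmega_mem_idealForms (j := j + 1)
      (Ideal.mem_sup_right (Ideal.mem_span_singleton_self a)) x)
      (idealForms_mono (le_sup_left : I ≤ I ⊔ Ideal.span {a}) _ h4)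
    rwa [sub_sub_cancel] at this
  obtain ⟨z, hz, u, hu, hzu⟩ := Submodule.mem_sup.1 (h _ h5)
  obtain ⟨u', hu', v, rfl⟩ := exists_of_mem_idealForms_sup hu
  have h6 : wedgeOmega f j (contractOmega c j x) =
      wedgeOmega f j u' + mulOmega a (j + 1) (wedgeOmega f j v) := by
    rw [← hzu, map_add, wedgeOmega_eq_zero_of_mem hz, zero_add, map_add, wedgeOmega_mulOmega]
  have h7 : mulOmega a (j + 1) (x - wedgeOmega f j v) ∈ idealForms I (j + 1) := by
    have := Submodule.add_mem _ h4 (wedgeOmega_mem_idealForms f hu')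
    rw [h6] at this
    rw [map_sub]
    convert this using 1
    abel
  exact Submodule.mem_sup.2 ⟨wedgeOmega f j v, ⟨v, rfl⟩, _, mem_idealForms_of_mulOmega_mem ha h7,
    add_sub_cancel _ _⟩

/-! ### Regular sequences of a linear form and powers of variables -/

open MvPolynomial in
-- The ideal is monomial, and none of its generators involves `X k`. Divisibility of a monomial by a
-- generator is therefore unaffected by the factor `X k ^ N`.
theorem mem_span_of_X_pow_mul_mem {i₀ k : Fin n} (hk : k ≠ i₀) {N : ℕ} {S : Finset (Fin n)}
    (hS : k ∉ S) {g : MvPolynomial (Fin n) ℂ}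
    (hg : X k ^ N * g ∈ Ideal.span (insert (X i₀ : MvPolynomial (Fin n) ℂ) ((fun i => X i ^ N) '' S))) :
    g ∈ Ideal.span (insert (X i₀ : MvPolynomial (Fin n) ℂ) ((fun i => X i ^ N) '' S)) := by
  classical
  have hs : insert (X i₀ : MvPolynomial (Fin n) ℂ) ((fun i => X i ^ N) '' S) =
      (fun s => monomial s 1) '' insert (Finsupp.single i₀ 1)
        ((fun i => Finsupp.single i N) '' (S : Set (Fin n))) := by
    rw [Set.image_insert_eq, Set.image_image]
    simp only [X_pow_eq_monomial]
    rfl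
  rw [hs, mem_ideal_span_monomial_image] at hg ⊢
  intro m hm
  obtain ⟨s, hs, hsm⟩ := hg (Finsupp.single k N + m) (by
    rw [mem_support_iff, X_pow_eq_monomial, coeff_monomial_mul, one_mul]
    exact mem_support_iff.1 hm)
  refine ⟨s, hs, ?_⟩
  rcases hs with rfl | ⟨i, hi, rfl⟩
  · have := hsm i₀
    rw [Finsupp.single_le_iff]
    simpa [Finsupp.single_apply, hk] using this
  · have := hsm i
    have hik : k ≠ i := fun h => hS (h ▸ hi)
    rw [Finsupp.single_le_iff]
    simpa [Finsupp.single_apply, hik] using this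

open MvPolynomial in
theorem mem_span_of_X_pow_mul_mem_of_linear (c : Fin n → ℂ) {i₀ k : Fin n} (hc : c i₀ ≠ 0)
    (hk : k ≠ i₀) {N : ℕ} {S : Finset (Fin n)} (hS : k ∉ S) (hi : i₀ ∉ S)
    {g : MvPolynomial (Fin n) ℂ}
    (hg : X k ^ N * g ∈ Ideal.span
      (insert (∑ i, C (c i) * X i : MvPolynomial (Fin n) ℂ) ((fun i => X i ^ N) '' S))) :
    g ∈ Ideal.span
      (insert (∑ i, C (c i) * X i : MvPolynomial (Fin n) ℂ) ((fun i => X i ^ N) '' S)) := by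
  classical
  set r : MvPolynomial (Fin n) ℂ := ∑ i ∈ Finset.univ.erase i₀, C (c i) * X i with hr
  have hl : ∑ i, C (c i) * X i = C (c i₀) * X i₀ + r :=
    (Finset.add_sum_erase _ _ (Finset.mem_univ i₀)).symm
  rw [hl] at hg ⊢
  -- The coordinate change sending `X i₀` to the linear form and fixing the other variables, with
  -- inverse `ψ`, reduces to the monomial case.
  let φ : MvPolynomial (Fin n) ℂ →ₐ[ℂ] MvPolynomial (Fin n) ℂ :=
    aeval fun i => if i = i₀ then C (c i₀) * X i₀ + r else X i
  let ψ : MvPolynomial (Fin n) ℂ →ₐ[ℂ] MvPolynomial (Fin n) ℂ :=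
    aeval fun i => if i = i₀ then C (c i₀)⁻¹ * (X i₀ - r) else X i
  have hφ : ∀ i ≠ i₀, φ (X i) = X i := fun i hi => by simp [φ, hi]
  have hψ : ∀ i ≠ i₀, ψ (X i) = X i := fun i hi => by simp [ψ, hi]
  have hφ₀ : φ (X i₀) = C (c i₀) * X i₀ + r := by simp [φ]
  have hψ₀ : ψ (X i₀) = C (c i₀)⁻¹ * (X i₀ - r) := by simp [ψ]
  have hC : ∀ (χ : MvPolynomial (Fin n) ℂ →ₐ[ℂ] MvPolynomial (Fin n) ℂ) (a : ℂ),
      χ (C a) = C a := fun χ a => χ.commutes a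
  have hfix : ∀ χ : MvPolynomial (Fin n) ℂ →ₐ[ℂ] MvPolynomial (Fin n) ℂ,
      (∀ i ≠ i₀, χ (X i) = X i) → χ r = r := fun χ h => by
    rw [hr, map_sum]
    refine Finset.sum_congr rfl fun i hi => ?_
    rw [map_mul, h i (Finset.ne_of_mem_erase hi), hC]
  have hcc : (C (c i₀) : MvPolynomial (Fin n) ℂ) * C (c i₀)⁻¹ = 1 := by
    rw [← C_mul, mul_inv_cancel₀ hc, C_1]
  have hψl : ψ (C (c i₀) * X i₀ + r) = X i₀ := by
    rw [map_add, map_mul, hC, hψ₀, hfix ψ hψ, ← mul_assoc, hcc]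
    ring
  have hφψ : ∀ p, φ (ψ p) = p := by
    intro p
    have h : φ.comp ψ = AlgHom.id ℂ _ := by
      refine algHom_ext fun i => ?_
      change φ (ψ (X i)) = X i
      by_cases hi : i = i₀
      · subst hi
        rw [hψ₀, map_mul, hC, map_sub, hφ₀, hfix φ hφ, add_sub_cancel_right, ← mul_assoc,
          mul_comm (C _⁻¹), hcc, one_mul]
      · rw [hψ i hi, hφ i hi]
    exact congrArg (fun χ : MvPolynomial (Fin n) ℂ →ₐ[ℂ] MvPolynomial (Fin n) ℂ => χ p) h
  have himg : ∀ χ : MvPolynomial (Fin n) ℂ →ₐ[ℂ] MvPolynomial (Fin n) ℂ,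
      (∀ i ≠ i₀, χ (X i) = X i) → ∀ p q, χ p = q →
      Ideal.map χ (Ideal.span (insert p ((fun i => X i ^ N) '' (S : Set (Fin n))))) =
        Ideal.span (insert q ((fun i => X i ^ N) '' S)) := by
    intro χ h p q hpq
    rw [Ideal.map_span, Set.image_insert_eq, Set.image_image, hpq]
    congr 2
    refine Set.image_congr fun i hi' => ?_
    rw [map_pow, h i (fun h => hi (h ▸ hi'))]
  have h1 := Ideal.mem_map_of_mem ψ hg
  rw [himg ψ hψ _ _ hψl, map_mul, map_pow, hψ k hk] at h1
  have h2 := Ideal.mem_map_of_mem φ (mem_span_of_X_pow_mul_mem hk hS h1)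
  rwa [himg φ hφ _ _ hφ₀, hφψ] at h2

open MvPolynomial in
-- Each step down in degree spends one variable outside `insert i₀ S`. The bound `j + S.card + 1 <
-- n` leaves the `j + 1` variables needed to pass through degree `0`.
theorem koszulExactMod_of_linear {f : MvPolynomial (Fin n) ℂ} (c : Fin n → ℂ) {i₀ : Fin n}
    (hc : c i₀ ≠ 0) {N : ℕ}
    (hN : ∀ k, (X k : MvPolynomial (Fin n) ℂ) ^ N ∈
      Ideal.span {∑ i, C (c i) * X i} ⊔ Ideal.span (Set.range fun i => pderiv i f))
    (j : ℕ) (S : Finset (Fin n)) (hi : i₀ ∉ S) (hS : j + S.card + 1 < n) :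
    KoszulExactMod f (Ideal.span
      (insert (∑ i, C (c i) * X i : MvPolynomial (Fin n) ℂ) ((fun i => X i ^ N) '' S))) j := by
  classical
  have key : ∀ (j : ℕ) (S : Finset (Fin n)), i₀ ∉ S → j + S.card + 1 < n → ∃ k ∉ S, k ≠ i₀ ∧
      ∃ b : Fin n → MvPolynomial (Fin n) ℂ,
      X k ^ N - ∑ i, b i * pderiv i f ∈ Ideal.span
        (insert (∑ i, C (c i) * X i : MvPolynomial (Fin n) ℂ) ((fun i => X i ^ N) '' S)) := by
    intro j S hi hS
    obtain ⟨k, hk⟩ : ∃ k, k ∉ insert i₀ S := by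
      by_contra! h
      have := Finset.card_le_card (fun k _ => h k : (Finset.univ : Finset (Fin n)) ⊆ insert i₀ S)
      rw [Finset.card_univ, Fintype.card_fin, Finset.card_insert_of_notMem hi] at this
      omega
    rw [Finset.mem_insert, not_or] at hk
    obtain ⟨y, hy, z, hz, hyz⟩ := Submodule.mem_sup.1 (hN k)
    obtain ⟨b, hb⟩ := Ideal.mem_span_range_iff_exists_fun.1 hz
    refine ⟨k, hk.2, hk.1, b, ?_⟩
    rw [hb, ← hyz, add_sub_cancel_right]
    exact Ideal.span_mono (Set.singleton_subset_iff.2 (Set.mem_insert _ _)) hy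
  induction j generalizing S with
  | zero =>
    obtain ⟨k, hk, hk₀, b, hb⟩ := key 0 S hi hS
    exact KoszulExactMod.zero b hb fun g =>
      mem_span_of_X_pow_mul_mem_of_linear c hc hk₀ hk hi
  | succ j ih =>
    obtain ⟨k, hk, hk₀, b, hb⟩ := key (j + 1) S hi hS
    refine KoszulExactMod.succ b hb (fun g =>
      mem_span_of_X_pow_mul_mem_of_linear c hc hk₀ hk hi) ?_
    have h := ih (insert k S) (by simp [hi, Ne.symm hk₀]) (by
      rw [Finset.card_insert_of_notMem hk]; omega)
    rwa [Finset.coe_insert, Set.image_insert_eq, Set.insert_comm, Ideal.span_insert, sup_comm] at h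

open MvPolynomial in
/-- If the partial derivatives of `f` together with a nonzero linear form have no common zero apart
from the origin, then the Koszul complex is exact below degree `n - 1`. -/
theorem mem_koszulBoundary_of_linear {f : MvPolynomial (Fin n) ℂ} {d : ℕ} (hf : f.IsHomogeneous d)
    (c : Fin n → ℂ) {i₀ : Fin n} (hc : c i₀ ≠ 0) {N : ℕ}
    (hN : ∀ k, (X k : MvPolynomial (Fin n) ℂ) ^ N ∈
      Ideal.span {∑ i, C (c i) * X i} ⊔ Ideal.span (Set.range fun i => pderiv i f))
    {j : ℕ} (hj : j + 1 < n) {x : Omega n j} (hx : wedgeOmega f j x = 0) :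
    x ∈ koszulBoundary f j := by
  set l : MvPolynomial (Fin n) ℂ := ∑ i, C (c i) * X i with hl
  have hl0 : l ≠ 0 := by
    intro h
    have h1 := congrArg (coeff (Finsupp.single i₀ 1)) h
    rw [hl, coeff_sum] at h1
    simp only [coeff_C_mul, coeff_X, coeff_zero] at h1
    rw [Finset.sum_eq_single i₀ (fun b _ hb => by
      rw [if_neg (fun h => hb (Finsupp.single_left_injective one_ne_zero h)), mul_zero]) (by simp)]
      at h1
    simp [hc] at h1
  have hl1 : l.IsHomogeneous 1 := IsHomogeneous.sum _ _ _ fun i _ => by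
    simpa using (isHomogeneous_C (Fin n) (c i)).mul (isHomogeneous_X ℂ i)
  -- Exactness modulo `l` gives `x = z + l y`, and `y` is again a cycle because `l` is a
  -- nonzerodivisor.
  have hdiv : ∀ x : Omega n j, wedgeOmega f j x = 0 →
      ∃ z ∈ koszulBoundary f j, ∃ y, wedgeOmega f j y = 0 ∧ x = z + mulOmega l j y := by
    intro x hx
    have h := koszulExactMod_of_linear c hc hN j ∅ (Finset.notMem_empty _) (by simpa using hj) x (by
      rw [hx]; exact Submodule.zero_mem _)
    obtain ⟨z, hz, u, hu, rfl⟩ := Submodule.mem_sup.1 h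
    obtain ⟨u', hu', y, rfl⟩ := exists_of_mem_idealForms_sup (I := ⊥) (a := l) (x := u)
      (by simpa using hu)
    obtain rfl := eq_zero_of_mem_idealForms_bot hu'
    rw [zero_add] at hx ⊢
    refine ⟨z, hz, y, ?_, rfl⟩
    rw [map_add, wedgeOmega_eq_zero_of_mem hz, zero_add, wedgeOmega_mulOmega] at hx
    refine eq_zero_of_mem_idealForms_bot (mem_idealForms_of_mulOmega_mem (a := l) (fun g hg => ?_) ?_)
    · exact (mul_eq_zero.1 ((Submodule.mem_bot _).1 hg)).resolve_left hl0
    · rw [hx]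
      exact Submodule.zero_mem _
  -- Division by `l` lowers the degree of the component by one, so iterating it ends in degree `0`,
  -- where no multiple of `l` contributes.
  refine mem_of_comp_mem _ fun m => ?_
  induction m generalizing x with
  | zero =>
    obtain ⟨z, hz, y, -, rfl⟩ := hdiv x hx
    rw [map_add, comp_mulOmega hl1, if_neg (by omega), add_zero]
    exact comp_mem_koszulBoundary hf 0 hz
  | succ m ih =>
    obtain ⟨z, hz, y, hy, rfl⟩ := hdiv x hx
    rw [map_add, comp_mulOmega hl1, if_pos (by omega)]
    exact Submodule.add_mem _ (comp_mem_koszulBoundary hf _ hz)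
      (mulOmega_mem_koszulBoundary l (ih hy))

/-! ### General linear sections of the singular locus -/

open MvPolynomial in
-- The homogeneous core of `P` is a prime that still contains the homogeneous ideal, so minimality
-- makes `P` homogeneous. A nonzero constant term would then be a unit in `P`.
theorem le_ker_constantCoeff_of_mem_minimalPrimes {s : Set (MvPolynomial (Fin n) ℂ)}
    (hs : ∀ p ∈ s, ∃ m, p.IsHomogeneous m) {P : Ideal (MvPolynomial (Fin n) ℂ)}
    (hP : P ∈ (Ideal.span s).minimalPrimes) : P ≤ RingHom.ker (constantCoeff (σ := Fin n) (R := ℂ)) := by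
  let _ : GradedAlgebra (homogeneousSubmodule (Fin n) ℂ) := gradedAlgebra
  have hI : (Ideal.span s).IsHomogeneous (homogeneousSubmodule (Fin n) ℂ) :=
    Ideal.homogeneous_span _ _ fun p hp => hs p hp
  have hprime : P.IsPrime := hP.1.1
  have hcore : P ≤ (P.homogeneousCore (homogeneousSubmodule (Fin n) ℂ)).toIdeal := by
    refine hP.2 ⟨hprime.homogeneousCore, ?_⟩ (Ideal.toIdeal_homogeneousCore_le _ _)
    rw [← hI.toIdeal_homogeneousCore_eq_self]
    exact Ideal.homogeneousCore_mono _ hP.1.2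
  have hhom : P.IsHomogeneous (homogeneousSubmodule (Fin n) ℂ) := by
    rw [Ideal.IsHomogeneous.iff_eq]
    exact le_antisymm (Ideal.toIdeal_homogeneousCore_le _ _) hcore
  intro p hp
  have h := homogeneousComponent_mem_of_mem hhom hp 0
  rw [homogeneousComponent_zero] at h
  rw [RingHom.mem_ker]
  by_contra hne
  exact hprime.ne_top (Ideal.eq_top_of_isUnit_mem _ h ((isUnit_iff_ne_zero.2 hne).map C))

theorem mem_minimalPrimes_or_isMaximal {R : Type*} [CommRing R] {J : Ideal R}
    (hJ : ringKrullDim (R ⧸ J) ≤ 1) {Q : Ideal R} [hQ : Q.IsPrime] (hJQ : J ≤ Q) :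
    Q ∈ J.minimalPrimes ∨ Q.IsMaximal := by
  have h1 : Ring.KrullDimLE 1 (R ⧸ J) := Ring.krullDimLE_iff.2 hJ
  have hker : RingHom.ker (Ideal.Quotient.mk J) ≤ Q := by rwa [Ideal.mk_ker]
  have hcm : (Q.map (Ideal.Quotient.mk J)).comap (Ideal.Quotient.mk J) = Q := by
    rw [Ideal.comap_map_of_surjective' _ Ideal.Quotient.mk_surjective, sup_eq_left.2 hker]
  have h2 : (Q.map (Ideal.Quotient.mk J)).IsPrime :=
    Ideal.map_isPrime_of_surjective Ideal.Quotient.mk_surjective hker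
  rcases Ring.krullDimLE_one_iff.1 h1 _ h2 with h | h
  · left
    refine ⟨⟨hQ, hJQ⟩, fun P hP hPQ => ?_⟩
    have hPker : RingHom.ker (Ideal.Quotient.mk J) ≤ P := by rw [Ideal.mk_ker]; exact hP.2
    have hPprime := hP.1
    have h3 := h.2 ⟨Ideal.map_isPrime_of_surjective Ideal.Quotient.mk_surjective hPker, bot_le⟩
      (Ideal.map_mono hPQ)
    have h4 := Ideal.comap_mono (f := Ideal.Quotient.mk J) h3
    rwa [hcm, Ideal.comap_map_of_surjective' _ Ideal.Quotient.mk_surjective,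
      sup_eq_left.2 hPker] at h4
  · right
    rw [← hcm]
    exact Ideal.comap_isMaximal_of_surjective _ Ideal.Quotient.mk_surjective

open MvPolynomial in
-- The coefficient vectors of linear forms in each `P` form a proper subspace, and finitely many
-- proper subspaces do not cover `ℂⁿ`.
theorem exists_linear_notMem (hn : 0 < n) (s : Set (Ideal (MvPolynomial (Fin n) ℂ))) (hs : s.Finite)
    (h : ∀ P ∈ s, ∃ i, (X i : MvPolynomial (Fin n) ℂ) ∉ P) :
    ∃ c : Fin n → ℂ, (∃ i, c i ≠ 0) ∧ ∀ P ∈ s, ∑ i, C (c i) * X i ∉ P := by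
  classical
  let L : (Fin n → ℂ) →ₗ[ℂ] MvPolynomial (Fin n) ℂ := Fintype.linearCombination ℂ fun i => X i
  have hL : ∀ c, L c = ∑ i, C (c i) * X i := fun c => by
    simp [L, Fintype.linearCombination_apply, smul_eq_C_mul]
  -- Including `⊥` among the subspaces to avoid forces `c ≠ 0`.
  let t : Finset (Subspace ℂ (Fin n → ℂ)) :=
    insert ⊥ (hs.toFinset.image fun P => (P.restrictScalars ℂ).comap L)
  have ht : ⊤ ∉ t := by
    intro h1
    rcases Finset.mem_insert.1 h1 with h1 | h1
    · have : (Pi.single ⟨0, hn⟩ 1 : Fin n → ℂ) ∈ (⊥ : Submodule ℂ (Fin n → ℂ)) := by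
        rw [← h1]; exact Submodule.mem_top
      rw [Submodule.mem_bot] at this
      simpa using congrFun this ⟨0, hn⟩
    · obtain ⟨P, hP, e⟩ := Finset.mem_image.1 h1
      obtain ⟨i, hi⟩ := h P (hs.mem_toFinset.1 hP)
      have : (Pi.single i 1 : Fin n → ℂ) ∈ (P.restrictScalars ℂ).comap L := by
        rw [e]; exact Submodule.mem_top
      refine hi ?_
      have h2 : L (Pi.single i 1) = X i := by
        simp [L, Fintype.linearCombination_apply_single]
      rw [← h2]
      exact this
  obtain ⟨c, hc⟩ := (Set.ne_univ_iff_exists_notMem _).1 (Subspace.biUnion_ne_univ_of_top_notMem ht)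
  simp only [Set.mem_iUnion, not_exists] at hc
  refine ⟨c, ?_, fun P hP hmem => ?_⟩
  · by_contra! h0
    exact hc ⊥ (Finset.mem_insert_self _ _) ((Submodule.mem_bot ℂ).2 (funext h0))
  · refine hc _ (Finset.mem_insert_of_mem (Finset.mem_image_of_mem _ (hs.mem_toFinset.2 hP))) ?_
    change L c ∈ P
    rwa [hL]

open MvPolynomial in
-- Euler's formula puts `f` in the ideal of its partial derivatives, as `d` is invertible in `ℂ`.
theorem singIdeal_eq_span {f : MvPolynomial (Fin n) ℂ} {d : ℕ} (hf : f.IsHomogeneous d)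
    (hd : d ≠ 0) : singIdeal f = Ideal.span (Set.range fun i => pderiv i f) := by
  refine le_antisymm (Ideal.span_le.2 (Set.insert_subset ?_ Ideal.subset_span))
    (Ideal.span_mono (Set.subset_insert _ _))
  have h := hf.sum_X_mul_pderiv
  have h1 : f = C (d : ℂ)⁻¹ * ∑ i, X i * pderiv i f := by
    rw [h, ← Nat.cast_smul_eq_nsmul ℂ, smul_eq_C_mul, ← mul_assoc, ← C_mul,
      inv_mul_cancel₀ (Nat.cast_ne_zero.2 hd), C_1, one_mul]
  have h2 : C (d : ℂ)⁻¹ * ∑ i, X i * pderiv i f ∈ Ideal.span (Set.range fun i => pderiv i f) :=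
    Ideal.mul_mem_left _ _ (Ideal.sum_mem _ fun i _ =>
      Ideal.mul_mem_left _ _ (Ideal.subset_span ⟨i, rfl⟩))
  rwa [← h1] at h2

open MvPolynomial in
-- The form `l` avoids every minimal prime of `J` that does not contain all variables.
theorem exists_linear_section (hn : 0 < n) {f : MvPolynomial (Fin n) ℂ} {d : ℕ}
    (hf : f.IsHomogeneous d)
    (hdim : ringKrullDim (MvPolynomial (Fin n) ℂ ⧸ Ideal.span (Set.range fun i => pderiv i f)) ≤ 1) :
    ∃ c : Fin n → ℂ, (∃ i, c i ≠ 0) ∧ ∃ N, ∀ k, (X k : MvPolynomial (Fin n) ℂ) ^ N ∈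
      Ideal.span {∑ i, C (c i) * X i} ⊔ Ideal.span (Set.range fun i => pderiv i f) := by
  set J := Ideal.span (Set.range fun i => pderiv i f) with hJ
  obtain ⟨c, hc, hcP⟩ := exists_linear_notMem hn
    {P | P ∈ J.minimalPrimes ∧ ∃ i, (X i : MvPolynomial (Fin n) ℂ) ∉ P}
    ((J.finite_minimalPrimes_of_isNoetherianRing _).subset fun P hP => hP.1) fun P hP => hP.2
  refine ⟨c, hc, ?_⟩
  set l : MvPolynomial (Fin n) ℂ := ∑ i, C (c i) * X i with hl
  have hspan : Ideal.span {l} ⊔ J = Ideal.span (insert l (Set.range fun i => pderiv i f)) := by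
    rw [Ideal.span_insert]
  have hrad : ∀ k, (X k : MvPolynomial (Fin n) ℂ) ∈ (Ideal.span {l} ⊔ J).radical := by
    intro k
    rw [Ideal.radical_eq_sInf, Ideal.mem_sInf]
    rintro Q ⟨hQ, hQprime⟩
    obtain ⟨Q₀, hQ₀, hle⟩ := Ideal.exists_minimalPrimes_le hQ
    refine hle ?_
    have hQ₀prime : Q₀.IsPrime := hQ₀.1.1
    have hJQ : J ≤ Q₀ := le_sup_right.trans hQ₀.1.2
    have hlQ : l ∈ Q₀ := hQ₀.1.2 (Ideal.mem_sup_left (Ideal.mem_span_singleton_self l))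
    have hm : Q₀ ≤ RingHom.ker (constantCoeff (σ := Fin n) (R := ℂ)) := by
      rw [hspan] at hQ₀
      refine le_ker_constantCoeff_of_mem_minimalPrimes ?_ hQ₀
      rintro p (rfl | ⟨i, rfl⟩)
      · exact ⟨1, IsHomogeneous.sum _ _ _ fun i _ => by
          simpa using (isHomogeneous_C (Fin n) (c i)).mul (isHomogeneous_X ℂ i)⟩
      · exact ⟨_, hf.pderiv⟩
    -- If `Q₀` is minimal over `J`, it contains all variables, as otherwise `l` would avoid it. If
    -- it is maximal, it equals the ideal of the origin, in which it is contained.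
    rcases mem_minimalPrimes_or_isMaximal hdim hJQ with h | h
    · by_contra hk
      exact hcP Q₀ ⟨h, k, hk⟩ hlQ
    · rw [h.eq_of_le (RingHom.ker_ne_top _) hm, RingHom.mem_ker, constantCoeff_X]
  choose N hN using hrad
  refine ⟨∑ i, N i, fun k => ?_⟩
  exact Ideal.pow_mem_of_pow_mem _ (hN k) (Finset.single_le_sum (f := N) (fun _ _ => Nat.zero_le _)
    (Finset.mem_univ k))

/-- The Koszul complex of the partial derivatives is exact below degree `n - 1` if the singular
locus has dimension at most one. -/
theorem mem_koszulBoundary_of_ringKrullDim_le_one {f : MvPolynomial (Fin n) ℂ} {d : ℕ}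
    (hf : f.IsHomogeneous d) (hd : d ≠ 0)
    (hA : ringKrullDim (MvPolynomial (Fin n) ℂ ⧸ singIdeal f) ≤ 1) {j : ℕ} (hj : j + 1 < n)
    {x : Omega n j} (hx : wedgeOmega f j x = 0) : x ∈ koszulBoundary f j := by
  rw [singIdeal_eq_span hf hd] at hA
  obtain ⟨c, ⟨i, hi⟩, N, hN⟩ := exists_linear_section (by omega) hf hA
  exact mem_koszulBoundary_of_linear hf c hi hN hj hx

end GaussManin
end

/-! ### Torsion of the Brieskorn module in terms of forms -/

noncomputable section

theorem CategoryTheory.ShortComplex.moduleCat_homologyπ_eq_zero_iff {k : Type} [CommRing k]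
    (S : ShortComplex (ModuleCat.{0} k)) (c : S.cycles) :
    S.homologyπ.hom c = 0 ↔ ∃ y, S.f.hom y = S.iCycles.hom c := by
  have hinj : Function.Injective S.moduleCatHomologyIso.hom.hom :=
    S.moduleCatHomologyIso.toLinearEquiv.injective
  rw [← map_eq_zero_iff _ hinj, ← LinearMap.comp_apply, ← ModuleCat.hom_comp,
    S.π_moduleCatCyclesIso_hom]
  refine (Submodule.Quotient.mk_eq_zero _).trans (exists_congr fun y => ?_)
  rw [← S.moduleCatCyclesIso_hom_i]
  exact Subtype.ext_iff (p := fun x => x ∈ LinearMap.ker S.g.hom)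

theorem CochainComplex.moduleCat_homologyπ_eq_zero_iff {k : Type} [CommRing k]
    (K : CochainComplex (ModuleCat.{0} k) ℕ) (j : ℕ) (c : K.cycles (j + 1)) :
    (K.homologyπ (j + 1)).hom c = 0 ↔
      ∃ y : K.X j, (K.d j (j + 1)).hom y = (K.iCycles (j + 1)).hom c := by
  refine ((K.sc (j + 1)).moduleCat_homologyπ_eq_zero_iff c).trans ?_
  -- The predecessor index equals `j` only propositionally, so the claim is generalized over the
  -- index before substituting.
  have h2 : ∀ i, i = j → ((∃ y : K.X i, (K.d i (j + 1)).hom y = (K.iCycles (j + 1)).hom c) ↔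
      ∃ y : K.X j, (K.d j (j + 1)).hom y = (K.iCycles (j + 1)).hom c) := by
    rintro i rfl; rfl
  exact h2 _ (CochainComplex.prev_nat_succ j)

theorem CochainComplex.moduleCat_exists_cycles {k : Type} [CommRing k]
    (K : CochainComplex (ModuleCat.{0} k) ℕ) (j : ℕ) (x : K.X j)
    (hx : (K.d j (j + 1)).hom x = 0) : ∃ c : K.cycles j, (K.iCycles j).hom c = x := by
  have hx' : (K.sc j).g.hom x = 0 := by
    have h2 : ∀ i, i = j + 1 → (K.d j i).hom x = 0 := by rintro i rfl; exact hx
    exact h2 _ ((ComplexShape.up ℕ).next_eq' rfl)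
  refine ⟨(K.sc j).moduleCatCyclesIso.inv.hom ⟨x, hx'⟩, ?_⟩
  exact congrArg (fun φ => φ.hom ⟨x, hx'⟩) (K.sc j).moduleCatCyclesIso_inv_iCycles

namespace GaussManin

variable {n : ℕ}

/-- The union of the kernels of `t^i` vanishes once `Ker t` does. In top degree every form is closed
and killed by `df ∧`, so the module is `Ω^{j+1} / d A_f^j`. -/
theorem brieskornTorsion_eq_bot_iff {j : ℕ} (f : MvPolynomial (Fin (j + 1)) ℂ) :
    brieskornTorsion f (j + 1) = ⊥ ↔ ∀ x : Omega (j + 1) (j + 1),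
      mulOmega f (j + 1) x ∈ (A f j).map (dOmega (j + 1) j) → x ∈ (A f j).map (dOmega (j + 1) j) := by
  have hπ : Function.Surjective ((complexA f).homologyπ (j + 1)).hom :=
    (ModuleCat.epi_iff_surjective _).1 inferInstance
  have hzero : ∀ c : (complexA f).cycles (j + 1), ((complexA f).homologyπ (j + 1)).hom c = 0 ↔
      (show A f (j + 1) from ((complexA f).iCycles (j + 1)).hom c).1 ∈
        (A f j).map (dOmega (j + 1) j) := by
    intro c
    rw [CochainComplex.moduleCat_homologyπ_eq_zero_iff, complexA_d]
    constructor
    · rintro ⟨y, hy⟩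
      exact ⟨y.1, y.2, congrArg Subtype.val hy⟩
    · rintro ⟨y, hy, e⟩
      exact ⟨⟨y, hy⟩, Subtype.ext e⟩
  have ht : ∀ c : (complexA f).cycles (j + 1),
      tBrieskorn f (j + 1) (((complexA f).homologyπ (j + 1)).hom c) = 0 ↔
      mulOmega f (j + 1) (show A f (j + 1) from ((complexA f).iCycles (j + 1)).hom c).1 ∈
        (A f j).map (dOmega (j + 1) j) := by
    intro c
    have h1 : tBrieskorn f (j + 1) (((complexA f).homologyπ (j + 1)).hom c) =
        ((complexA f).homologyπ (j + 1)).hom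
          ((HomologicalComplex.cyclesMap (tA f) (j + 1)).hom c) :=
      congrArg (fun φ => φ.hom c) (HomologicalComplex.homologyπ_naturality (tA f) (j + 1))
    have h2 : ((complexA f).iCycles (j + 1)).hom
        ((HomologicalComplex.cyclesMap (tA f) (j + 1)).hom c) =
        ((tA f).f (j + 1)).hom (((complexA f).iCycles (j + 1)).hom c) :=
      congrArg (fun φ => φ.hom c) (HomologicalComplex.cyclesMap_i (tA f) (j + 1))
    rw [h1, hzero, h2]
    rfl
  have hinj : brieskornTorsion f (j + 1) = ⊥ ↔ ∀ y, tBrieskorn f (j + 1) y = 0 → y = 0 := by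
    rw [brieskornTorsion, iSup_eq_bot]
    constructor
    · intro h y hy
      have := h 1
      rw [pow_one, LinearMap.ker_eq_bot'] at this
      exact this y hy
    · intro h i
      rw [LinearMap.ker_eq_bot']
      induction i with
      | zero => exact fun y hy => hy
      | succ i ih =>
        intro y hy
        rw [pow_succ] at hy
        exact h y (ih _ hy)
  rw [hinj]
  constructor
  · intro h x hx
    have hxA : x ∈ A f (j + 1) := Omega_eq_zero (Nat.lt_succ_self _) _
    obtain ⟨c, hc⟩ := CochainComplex.moduleCat_exists_cycles (complexA f) (j + 1) ⟨x, hxA⟩ (by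
      rw [complexA_d]
      exact Subtype.ext (Omega_eq_zero (Nat.lt_succ_self _) _))
    have h1 := (hzero c).1 (h _ ((ht c).2 (by rw [hc]; exact hx)))
    rwa [hc] at h1
  · intro h y hy
    obtain ⟨c, rfl⟩ := hπ y
    exact (hzero c).2 (h _ ((ht c).1 hy))

/-! ### Splitting of chains -/

theorem chainEnd_le_succ (f : MvPolynomial (Fin n) ℂ) (j k : ℕ) :
    chainEnd f j k ≤ chainEnd f j (k + 1) := by
  induction k with
  | zero => exact fun x hx => ⟨0, Submodule.zero_mem _, by
      rw [map_zero]; exact (mem_chainEnd_zero.1 hx).symm⟩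
  | succ k ih => exact fun x ⟨y, hy, e⟩ => ⟨y, ih hy, e⟩

/-- The condition that all chains in degree `j` split off. -/
def ChainsSplit (f : MvPolynomial (Fin n) ℂ) (j : ℕ) : Prop :=
  ∀ k, (chainEnd f j k).map (dOmega n j) ≤ (A f j).map (dOmega n j)

theorem A_le_chainEnd (f : MvPolynomial (Fin n) ℂ) (j k : ℕ) : A f j ≤ chainEnd f j k := by
  induction k with
  | zero => exact le_rfl
  | succ k ih => exact ih.trans (chainEnd_le_succ f j k)

theorem wedgeOmega_mem_A (f : MvPolynomial (Fin n) ℂ) {j : ℕ} (x : Omega n j) :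
    wedgeOmega f j x ∈ A f (j + 1) :=
  wedgeOmega_wedgeOmega f x

/-- Since `df ∧ dx = d(-df ∧ x)` with `df ∧ x ∈ A_f`, changing a form by an exact one does not
affect whether its wedge with `df` lies in `d A_f`. -/
theorem wedgeOmega_dOmega_mem (f : MvPolynomial (Fin n) ℂ) {j : ℕ} (x : Omega n j) :
    wedgeOmega f (j + 1) (dOmega n j x) ∈ (A f (j + 1)).map (dOmega n (j + 1)) :=
  ⟨-wedgeOmega f j x, Submodule.neg_mem _ (wedgeOmega_mem_A f x), by
    rw [map_neg, dOmega_wedgeOmega, neg_neg]⟩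

/-- Every chain end is an element of `A_f` plus a closed form. If `df ∧ x = da` with `a = df ∧ z`,
then `df ∧ (x + dz) = 0`, and `-dz` is the closed part. -/
theorem chainsSplit_of_koszulExact {f : MvPolynomial (Fin n) ℂ} {j : ℕ}
    (h : ∀ x : Omega n j, wedgeOmega f j x = 0 → x ∈ koszulBoundary f j) : ChainsSplit f j := by
  have key : ∀ k, ∀ x ∈ chainEnd f j k, ∃ a ∈ A f j, ∃ b, dOmega n j b = 0 ∧ x = a + b := by
    intro k
    induction k with
    | zero => exact fun x hx => ⟨x, hx, 0, map_zero _, (add_zero x).symm⟩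
    | succ k ih =>
      rintro x ⟨y, hy, e⟩
      obtain ⟨a, ha, b, hb, rfl⟩ := ih y hy
      rw [map_add, hb, add_zero] at e
      have h1 := h a ha
      cases j with
      | zero =>
        rw [(Submodule.mem_bot ℂ).1 h1, map_zero] at e
        exact ⟨x, e.symm, 0, map_zero _, (add_zero x).symm⟩
      | succ j =>
        obtain ⟨z, rfl⟩ := h1
        refine ⟨x + dOmega n j z, ?_, -dOmega n j z, ?_, ?_⟩
        · change wedgeOmega f (j + 1) (x + dOmega n j z) = 0
          rw [map_add, ← e, dOmega_wedgeOmega, neg_add_cancel]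
        · rw [map_neg, dOmega_dOmega, neg_zero]
        · rw [add_neg_cancel_right]
  rintro k _ ⟨x, hx, rfl⟩
  obtain ⟨a, ha, b, hb, rfl⟩ := key k x hx
  rw [map_add, hb, add_zero]
  exact Submodule.mem_map_of_mem ha

theorem chainsSplit_of_lt {f : MvPolynomial (Fin n) ℂ} {j : ℕ} (h : n < j + 1) :
    ChainsSplit f j := fun k x _ => by
  rw [Omega_eq_zero h x]
  exact Submodule.zero_mem _

theorem A_eq_top_of_isHomogeneous_zero {f : MvPolynomial (Fin n) ℂ} (hf : f.IsHomogeneous 0)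
    (j : ℕ) : A f j = ⊤ := by
  have h : ∀ i, MvPolynomial.pderiv i f = 0 := fun i => by
    rw [MvPolynomial.totalDegree_eq_zero_iff_eq_C.1
      (Nat.le_zero.1 hf.totalDegree_le), MvPolynomial.pderiv_C]
  rw [A, LinearMap.ker_eq_top]
  refine LinearMap.ext fun x => ?_
  induction x using Omega.induction with
  | zero => rw [map_zero, map_zero]
  | add x y hx hy => rw [map_add, map_add, hx, hy]
  | form g w => simp [wedgeOmega_form, h, form_zero_left]

theorem comp_mem_A {f : MvPolynomial (Fin n) ℂ} {d : ℕ} (hf : f.IsHomogeneous d) (m : ℕ) {j : ℕ}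
    {x : Omega n j} (hx : x ∈ A f j) : comp m j x ∈ A f j := by
  have h := comp_wedgeOmega hf (m + (d - 1)) x
  rw [show wedgeOmega f j x = 0 from hx, map_zero, if_pos (by omega), Nat.add_sub_cancel] at h
  exact h.symm

theorem comp_mem_map_A {f : MvPolynomial (Fin n) ℂ} {d : ℕ} (hf : f.IsHomogeneous d) (m : ℕ) {j : ℕ}
    {x : Omega n (j + 1)} (hx : x ∈ (A f j).map (dOmega n j)) :
    comp m (j + 1) x ∈ (A f j).map (dOmega n j) := by
  obtain ⟨a, ha, rfl⟩ := hx
  exact ⟨_, comp_mem_A hf (m + 1) ha, dOmega_comp_succ m a⟩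

theorem comp_mem_chainEnd {f : MvPolynomial (Fin n) ℂ} {d : ℕ} (hf : f.IsHomogeneous d) {j k : ℕ}
    (m : ℕ) {x : Omega n j} (hx : x ∈ chainEnd f j k) : comp m j x ∈ chainEnd f j k := by
  induction k generalizing x m with
  | zero => exact comp_mem_A hf m hx
  | succ k ih =>
    obtain ⟨y, hy, e⟩ := hx
    -- Wedging with `df` raises the degree by `d - 1` and `d` lowers it by one.
    refine ⟨comp (m + (d - 1) + 1) j y, ih _ hy, ?_⟩
    rw [dOmega_comp_succ, e, comp_wedgeOmega hf, if_pos (by omega), Nat.add_sub_cancel]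

/-- In `dx = da + df ∧ b` the form `b` is the end of a longer chain and has smaller coefficient
degree than `x`. By induction `b` is in `A_f` up to an exact form, so `df ∧ b ∈ d A_f`. -/
theorem chainsSplit_of_le_sup {f : MvPolynomial (Fin n) ℂ} {d : ℕ} (hf : f.IsHomogeneous d) {j : ℕ}
    (h : ∀ k, (chainEnd f (j + 1) k).map (dOmega n (j + 1)) ≤
      (A f (j + 1)).map (dOmega n (j + 1)) ⊔ LinearMap.range (wedgeOmega f (j + 1))) :
    ChainsSplit f (j + 1) := by
  have key : ∀ m k, ∀ x ∈ chainEnd f (j + 1) k,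
      dOmega n (j + 1) (comp m (j + 1) x) ∈ (A f (j + 1)).map (dOmega n (j + 1)) := by
    intro m
    induction m using Nat.strong_induction_on with
    | _ m ih =>
      intro k x hx
      cases m with
      | zero =>
        rw [dOmega_comp_zero]
        exact Submodule.zero_mem _
      | succ m =>
        have hx' := comp_mem_chainEnd hf (m + 1) hx
        obtain ⟨_, ⟨a, ha, rfl⟩, _, ⟨b, rfl⟩, e⟩ :=
          Submodule.mem_sup.1 (h k (Submodule.mem_map_of_mem hx'))
        have ha' := comp_mem_A hf (m + 1) ha
        have e' := congrArg (comp m (j + 1 + 1)) e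
        rw [← dOmega_comp_succ, comp_comp, map_add, ← dOmega_comp_succ, comp_wedgeOmega hf] at e'
        rw [← e']
        refine Submodule.add_mem _ (Submodule.mem_map_of_mem ha') ?_
        split_ifs at e' ⊢ with hm
        · have hb : comp (m - (d - 1)) (j + 1) b ∈ chainEnd f (j + 1) (k + 1) :=
            ⟨comp (m + 1) (j + 1) x - comp (m + 1) (j + 1) a,
              Submodule.sub_mem _ hx' (A_le_chainEnd f _ _ ha'), by
                rw [map_sub, ← e', add_sub_cancel_left]⟩
          obtain ⟨a', ha', e''⟩ := ih (m - (d - 1)) (by omega) _ _ hb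
          rw [comp_comp] at e''
          obtain ⟨z, hz⟩ := exists_dOmega_eq
            (x := comp (m - (d - 1)) (j + 1) b - a') (by rw [map_sub, e'', sub_self])
          have h1 := wedgeOmega_dOmega_mem f z
          rwa [hz, map_sub, show wedgeOmega f (j + 1) a' = 0 from ha', sub_zero] at h1
        · exact Submodule.zero_mem _
  rintro k _ ⟨x, hx, rfl⟩
  have h1 : x ∈ ((A f (j + 1)).map (dOmega n (j + 1))).comap (dOmega n (j + 1)) :=
    mem_of_comp_mem _ fun m => key m k x hx
  exact h1

/-- A homogeneous form `ω` of top degree is `dη` with `df ∧ η` proportional to `f ω`. -/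
theorem exists_primitive {j : ℕ} {f : MvPolynomial (Fin (j + 1)) ℂ} {d : ℕ} (hf : f.IsHomogeneous d)
    (hd : d ≠ 0) (m : ℕ) (x : Omega (j + 1) (j + 1)) :
    ∃ y, dOmega (j + 1) j y = comp m (j + 1) x ∧ ∃ c : ℂ, c ≠ 0 ∧
      wedgeOmega f j y = c • mulOmega f (j + 1) (comp m (j + 1) x) := by
  have he : ((m + (j + 1) : ℕ) : ℂ) ≠ 0 := Nat.cast_ne_zero.2 (by omega)
  refine ⟨((m + (j + 1) : ℕ) : ℂ)⁻¹ • contractOmega MvPolynomial.X j (comp m (j + 1) x), ?_,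
    ((m + (j + 1) : ℕ) : ℂ)⁻¹ * d, mul_ne_zero (inv_ne_zero he) (Nat.cast_ne_zero.2 hd), ?_⟩
  · have h := lie_euler_comp m x
    rw [Omega_eq_zero (Nat.lt_succ_self _) (dOmega _ _ _), map_zero, zero_add] at h
    rw [map_smul, h, smul_smul, inv_mul_cancel₀ he, one_smul]
  · have h := contractOmega_wedgeOmega MvPolynomial.X f (comp m (j + 1) x)
    rw [Omega_eq_zero (Nat.lt_succ_self _) (wedgeOmega _ _ _), map_zero, zero_add,
      hf.sum_X_mul_pderiv] at h
    rw [map_smul, h, ← smul_smul]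
    congr 1
    generalize comp m (j + 1) x = y
    induction y using Omega.induction with
    | zero => simp
    | add y z hy hz => rw [map_add, map_add, hy, hz, smul_add]
    | form g w =>
      rw [mulOmega_form, mulOmega_form, ← form_smul, ← Nat.cast_smul_eq_nsmul ℂ, smul_mul_assoc]

/-- Any two primitives of a top form differ by an exact form, so a chain end may be replaced by the
Euler primitive of its differential. For that primitive, wedging with `df` is multiplication by `f`
up to a nonzero constant. -/
theorem chainsSplit_iff_mulOmega {j : ℕ} {f : MvPolynomial (Fin (j + 2)) ℂ} {d : ℕ}
    (hf : f.IsHomogeneous d) (hd : d ≠ 0) :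
    ChainsSplit f (j + 1) ↔ ∀ x : Omega (j + 2) (j + 2),
      mulOmega f (j + 2) x ∈ (A f (j + 1)).map (dOmega (j + 2) (j + 1)) →
        x ∈ (A f (j + 1)).map (dOmega (j + 2) (j + 1)) := by
  constructor
  · intro h x hx
    refine mem_of_comp_mem _ fun m => ?_
    obtain ⟨y, hy, c, -, hyc⟩ := exists_primitive hf hd m x
    have h1 := comp_mem_map_A hf (m + d) hx
    rw [comp_mulOmega hf, if_pos (by omega), Nat.add_sub_cancel] at h1
    rw [← hy]
    -- The Euler primitive `y` ends a chain of two forms, because `df ∧ y` is a multiple of `f ·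
    -- dy`, which lies in `d A_f`.
    refine h 1 (Submodule.mem_map_of_mem ?_)
    change wedgeOmega f (j + 1) y ∈ (A f (j + 1)).map (dOmega (j + 2) (j + 1))
    rw [hyc]
    exact Submodule.smul_mem _ c h1
  · intro h k
    induction k with
    | zero => exact le_rfl
    | succ k ih =>
      rintro _ ⟨x, hx, rfl⟩
      refine mem_of_comp_mem _ fun m => ?_
      obtain ⟨y, hy, c, hc, hyc⟩ := exists_primitive hf hd m (dOmega (j + 2) (j + 1) x)
      have h1 : wedgeOmega f (j + 1) (comp (m + 1) (j + 1) x) ∈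
          (A f (j + 1)).map (dOmega (j + 2) (j + 1)) :=
        ih (comp_mem_chainEnd hf (m + 1) hx)
      obtain ⟨z, hz⟩ := exists_dOmega_eq (x := comp (m + 1) (j + 1) x - y) (by
        rw [map_sub, hy, dOmega_comp_succ, sub_self])
      have h2 := Submodule.sub_mem _ h1 (wedgeOmega_dOmega_mem f z)
      rw [hz, ← map_sub, sub_sub_cancel, hyc] at h2
      exact h _ ((Submodule.smul_mem_iff _ hc).1 h2)

end GaussManin
end

/-! ### All three conditions as splitting of chains in degree `n - 1` -/

open GaussManin in
theorem corollary4p7 (n : ℕ) (hn : 2 ≤ n) (d : ℕ) (f : MvPolynomial (Fin n) ℂ)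
    (hf : f.IsHomogeneous d)
    (hA : ringKrullDim (MvPolynomial (Fin n) ℂ ⧸ GaussManin.singIdeal f) ≤ 1) :
    List.TFAE
      [(GaussManin.gaussManin f).DegeneratesAt 2,
       (GaussManin.microlocalGaussManin f).DegeneratesAt 2,
       GaussManin.brieskornTorsion f n = ⊥] := by
  obtain ⟨i, rfl⟩ := Nat.exists_eq_add_of_le' hn
  have hne : ∀ j, j ≠ i + 1 → ChainsSplit f j := by
    intro j hj
    rcases lt_or_gt_of_ne hj with h | h
    -- Constant `f` is treated apart: Euler's formula is then useless, but `A_f` is all of `Ω^•`.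
    · by_cases hd : d = 0
      · subst hd
        intro k
        rw [A_eq_top_of_isHomogeneous_zero hf]
        exact Submodule.map_mono le_top
      · exact chainsSplit_of_koszulExact fun x hx =>
          mem_koszulBoundary_of_ringKrullDim_le_one hf hd hA (by omega) hx
    · exact chainsSplit_of_lt (by omega)
  have h1 : (gaussManin f).DegeneratesAt 2 ↔ ChainsSplit f (i + 1) := by
    rw [gaussManin_degeneratesAt_two_iff]
    refine ⟨fun h => h (i + 1), fun h j => ?_⟩
    by_cases hj : j = i + 1
    · exact hj ▸ h
    · exact hne j hj
  have h2 : (microlocalGaussManin f).DegeneratesAt 2 ↔ ChainsSplit f (i + 1) := by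
    rw [microlocalGaussManin_degeneratesAt_two_iff]
    refine ⟨fun h => chainsSplit_of_le_sup hf (h (i + 1)), fun h j k => ?_⟩
    by_cases hj : j = i + 1
    · subst hj
      exact (h k).trans le_sup_left
    · exact (hne j hj k).trans le_sup_left
  have h3 : brieskornTorsion f (i + 2) = ⊥ ↔ ChainsSplit f (i + 1) := by
    rw [brieskornTorsion_eq_bot_iff]
    by_cases hd : d = 0
    · subst hd
      have hA := A_eq_top_of_isHomogeneous_zero hf (i + 1)
      refine iff_of_true (fun x _ => ?_) fun k => ?_
      · obtain ⟨y, rfl⟩ := exists_dOmega_eq (x := x) (Omega_eq_zero (Nat.lt_succ_self _) _)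
        exact ⟨y, by rw [hA]; trivial, rfl⟩
      · rw [hA]
        exact Submodule.map_mono le_top
    · exact (chainsSplit_iff_mulOmega hf hd).symm
  tfae_have 1 ↔ 2 := h1.trans h2.symm
  tfae_have 1 ↔ 3 := h1.trans h3.symm
  tfae_finish
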